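/- **Set Cover in the oracle model.** An instance consists of $n$ elements and a family of $m$ sets $S_1,\dots,S_m$ of elements, with $m\ge n$. It is accessed through two oracles: $\mathrm{EltOf}(S_i,j)$ returns the $j$-th element of $S_i$ (or $\bot$ if $j>|S_i|$), and $\mathrm{SetOf}(e,j)$ returns the $j$-th set containing $e$ (or $\bot$ if $e$ lies in fewer than $j$ sets); the lists of elements and of sets may be in arbitrary order. Let $\mathrm{OPT}$ be the minimum number of sets in the family whose union contains all elements. A randomized algorithm is a probability distribution over deterministic adaptive query algorithms; it solves a problem with success probability $p$ if on every instance (with $n$ elements and $m$ sets) that admits a cover its output is correct with probability at least $p$. **Theorem.** There are absolute constants $c>0$ and $d\in\mathbb N$ such that the following holds for all integers $n\le m$, $k$ and all real $\alpha$ with $$1<\alpha\le\log n,\qquad 2\le k\le\Bigl(\frac{n}{16\,\alpha\log m}\Bigr)^{1/(4\alpha+1)},$$ where $\log$ is the natural logarithm. Every randomized algorithm that, with success probability at least $2/3$, outputs an $\alpha$-approximate set cover (a cover with at most $\alpha\cdot\mathrm{OPT}$ sets) makes, with positive probability, at least $$\frac{c\,m\,(n/k)^{1/(2\alpha)}}{(\log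 m)^{d}}=\tilde\Omega\bigl(m(n/k)^{1/(2\alpha)}\bigr)$$ oracle queries on some instance with $\mathrm{OPT}=k$. The same holds for every randomized algorithm that, with success probability at least $2/3$, only outputs a number $v$ with $\mathrm{OPT}\le v\le\alpha\cdot\mathrm{OPT}$. -/

import Mathlib

/-- A set cover input with elements `e_0, …, e_{n-1}` and sets `S_0, …, S_{m-1}`, in adjacency-list
representation: `elts S` lists the elements of the set `S`, and `sets e` lists the sets that contain
the element `e`. Both kinds of lists are free of repetitions, may come in any order, and
describe the same incidence relation. -/
structure SetSystem (n m : ℕ) where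
  elts : Fin m → List (Fin n)
  sets : Fin n → List (Fin m)
  elts_nodup : ∀ S, (elts S).Nodup
  sets_nodup : ∀ e, (sets e).Nodup
  mem_iff : ∀ S e, e ∈ elts S ↔ S ∈ sets e

namespace SetSystem

variable {n m : ℕ}

/-- `C` is a set cover: every element lies in some set of the subfamily `C`. -/
def IsCover (I : SetSystem n m) (C : Finset (Fin m)) : Prop :=
  ∀ e : Fin n, ∃ S ∈ C, e ∈ I.elts S

/-- A set cover exists, and the minimum size of a set cover is `k`. -/
def HasOpt (I : SetSystem n m) (k : ℕ) : Prop :=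
  IsLeast {t : ℕ | ∃ C : Finset (Fin m), I.IsCover C ∧ C.card = t} k

/-- `C` is an `α`-approximate set cover: a cover of size at most `α` times the minimum. -/
def IsApproxCover (α : ℝ) (I : SetSystem n m) (C : Finset (Fin m)) : Prop :=
  I.IsCover C ∧ ∃ t : ℕ, I.HasOpt t ∧ (C.card : ℝ) ≤ α * t

/-- `v` is an `α`-approximate estimate of the minimum size `OPT` of a set cover:
`OPT ≤ v ≤ α * OPT`. -/
def IsApproxValue (α : ℝ) (I : SetSystem n m) (v : ℝ) : Prop :=
  ∃ t : ℕ, I.HasOpt t ∧ (t : ℝ) ≤ v ∧ v ≤ α * t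

end SetSystem

/-- A deterministic (adaptive) algorithm in the oracle model, for inputs with `n` elements and `m`
sets, with outputs in `Out`. It either stops with an output, or asks one oracle query and
continues depending on the answer:
* `eltOf S j`: the `j`-th element of the set `S`, or `none` if there is none;
* `setOf e j`: the `j`-th set that contains the element `e`, or `none` if there is none.
Positions in the lists are counted from `0`. -/
inductive QueryAlgorithm (n m : ℕ) (Out : Type) : Type where
  | output (o : Out) : QueryAlgorithm n m Out
  | eltOf (S : Fin m) (j : ℕ) (next : Option (Fin n) → QueryAlgorithm n m Out) :
      QueryAlgorithm n m Out
  | setOf (e : Fin n) (j : ℕ) (next : Option (Fin m) → QueryAlgorithm n m Out) :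
      QueryAlgorithm n m Out

namespace QueryAlgorithm

variable {n m : ℕ} {Out : Type}

/-- The output of the algorithm on the input `I`. -/
def run (I : SetSystem n m) : QueryAlgorithm n m Out → Out
  | output o => o
  | eltOf S j next => run I (next (I.elts S)[j]?)
  | setOf e j next => run I (next (I.sets e)[j]?)

/-- The number of oracle queries the algorithm makes on the input `I`. -/
def queries (I : SetSystem n m) : QueryAlgorithm n m Out → ℕ
  | output _ => 0
  | eltOf S j next => queries I (next (I.elts S)[j]?) + 1
  | setOf e j next => queries I (next (I.sets e)[j]?) + 1

end QueryAlgorithm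

/-- The randomized algorithm that draws `ω` from `μ` and then runs the deterministic algorithm `A ω`
solves the problem `correct` with success probability at least `p`: on every input that
has a set cover at all, the output is correct with probability at least `p`. -/
def SolvesWithProb {n m : ℕ} {Out : Type} {Ω : Type*} [MeasurableSpace Ω]
    (μ : MeasureTheory.Measure Ω) (A : Ω → QueryAlgorithm n m Out)
    (correct : SetSystem n m → Out → Prop) (p : ℝ) : Prop :=
  ∀ I : SetSystem n m, (∃ C, I.IsCover C) →
    MeasurableSet {ω | correct I ((A ω).run I)} ∧ p ≤ μ.real {ω | correct I ((A ω).run I)}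

/-!
The proof compares one instance of large optimum with a family of instances of optimum `k` that are
locally almost indistinguishable from it.

Let `a = ⌊α * k⌋`. Every nonempty set of the unmodified instance has one of `D` types, and a main
element `e` is avoided by the sets whose type lies in a block `Z e`. The blocks form a covering design:
any `a` types lie in a common block, so `a` sets never form a cover
(`HardInstance.lt_card_of_isCover_base`). Random blocks of size `z` do this with few elements
(`exists_coveringDesign`, a union bound), and the fraction of main elements that `k` random types
leave uncovered is about `(z / D) ^ k`.

A modified instance hides a cover of `k` sets of random types. The main elements that these types
leave uncovered are added to one of the `k` sets, the head set, by exchanges that preserve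
all list lengths: the head set swaps a filler, which the other hidden sets contain as well,
for the uncovered element `e`, and a partner set swaps `e` for the filler
(`setExchange`, `elementExchange`). Marker elements ensure that the optimum is not below `k`
(`HardInstance.hasOpt_modified`).

A query reveals a modification only if it hits an exchanged incidence. For an incidence of a head set
with a filler this happens if the set is the hidden one among the order of `m` head sets and the
filler is used, for one of a partner set with `e` if `e` is left uncovered and the partner is the
chosen one among the order of `(1 - z / D) * m`. Both have probability at most of the order of
`(z / D) ^ k / ((1 - z / D) * m)` (`HardInstance.card_displaced_le`). So an algorithm with few
queries on the modified instances mostly answers as on the unmodified one, where no correct output is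
correct for the modified ones (`QueryAlgorithm.exists_pos_measure_le_queries`).

Finally, with `y = (n / k) ^ (1 / (2 * α))`, blocks with `(z / D) ^ k` of the order of `1 / (k * y)`
suffice: then `1 - z / D` is at least of the order of `1 / k`, and the number of queries is at least of
the order of `m * y`. The bound on `k` ensures that `n` elements are enough for such a design
(`hasSparseDesign_of_log_le`; for bounded `n`, `hasSparseDesign_of_mul_le`).
-/

/-! ### Indistinguishable instances -/

namespace QueryAlgorithm

/-- If every query tells few members of a family of instances apart from `I₀`, then an algorithm that
makes few queries on the members treats few of them differently from `I₀`. The bound on the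
queries concerns the members only: on `I₀` the algorithm may ask arbitrarily many. -/
theorem card_filter_run_ne_le {n m : ℕ} {Out : Type} {X : Type*} [Fintype X] (I₀ : SetSystem n m)
    (I : X → SetSystem n m) {B : ℝ} (hB : 0 ≤ B)
    (helt : ∀ (S : Fin m) (j : ℕ), (Nat.card {x // ((I x).elts S)[j]? ≠ (I₀.elts S)[j]?} : ℝ) ≤ B)
    (hset : ∀ (e : Fin n) (j : ℕ), (Nat.card {x // ((I x).sets e)[j]? ≠ (I₀.sets e)[j]?} : ℝ) ≤ B)
    (A : QueryAlgorithm n m Out) (q : ℕ) :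
    (Nat.card {x // A.queries (I x) ≤ q ∧ A.run (I x) ≠ A.run I₀} : ℝ) ≤ q * B := by
  classical
  -- the common step of the two kinds of queries
  have step : ∀ {β : Type} (ans : SetSystem n m → β) (next : β → QueryAlgorithm n m Out)
      (A : QueryAlgorithm n m Out)
      (_ : ∀ J, A.run J = (next (ans J)).run J)
      (_ : ∀ J, A.queries J = (next (ans J)).queries J + 1)
      (_ : (Nat.card {x // ans (I x) ≠ ans I₀} : ℝ) ≤ B)
      (_ : ∀ b (q : ℕ), (Nat.card {x // (next b).queries (I x) ≤ q ∧
        (next b).run (I x) ≠ (next b).run I₀} : ℝ) ≤ q * B) (q : ℕ),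
      (Nat.card {x // A.queries (I x) ≤ q ∧ A.run (I x) ≠ A.run I₀} : ℝ) ≤ q * B := by
    intro β ans next A hrun hq hB ih q
    rcases q with _ | q
    · simp [hq]
    · have h := ih (ans I₀) q
      simp only [Nat.card_eq_fintype_card, Fintype.card_subtype] at h hB ⊢
      have hsub : (Finset.univ.filter fun x => A.queries (I x) ≤ q + 1 ∧ A.run (I x) ≠ A.run I₀) ⊆
          (Finset.univ.filter fun x => ans (I x) ≠ ans I₀) ∪
          (Finset.univ.filter fun x => (next (ans I₀)).queries (I x) ≤ q ∧
            (next (ans I₀)).run (I x) ≠ (next (ans I₀)).run I₀) := by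
        intro x
        simp only [Finset.mem_union, Finset.mem_filter, Finset.mem_univ, true_and, hrun, hq]
        rintro ⟨h1, h2⟩
        by_cases hx : ans (I x) = ans I₀
        · right
          rw [hx] at h1 h2
          exact ⟨by omega, h2⟩
        · exact Or.inl hx
      have h3 := (Finset.card_le_card hsub).trans (Finset.card_union_le _ _)
      have h4 : ((Finset.univ.filter fun x => A.queries (I x) ≤ q + 1 ∧
          A.run (I x) ≠ A.run I₀).card : ℝ) ≤ B + q * B := by
        refine le_trans (by exact_mod_cast h3) (add_le_add hB h)
      refine h4.trans (le_of_eq ?_)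
      push_cast; ring
  induction A generalizing q with
  | output o =>
    simpa [run] using mul_nonneg (Nat.cast_nonneg q) hB
  | eltOf S j next ih =>
    exact step (fun J => (J.elts S)[j]?) next _ (fun J => rfl) (fun J => rfl) (helt S j) ih q
  | setOf e j next ih =>
    exact step (fun J => (J.sets e)[j]?) next _ (fun J => rfl) (fun J => rfl) (hset e j) ih q

open MeasureTheory in
/-- A randomized algorithm that solves a problem on `I₀` and on a family of instances with disjoint
sets of correct outputs must ask many queries on a member of the family, when every
query tells few members apart from `I₀`. -/
theorem exists_pos_measure_le_queries {n m : ℕ} {Out : Type} {Ω X : Type*} [MeasurableSpace Ω]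
    (μ : Measure Ω) [IsProbabilityMeasure μ] [Fintype X] [Nonempty X]
    {A : Ω → QueryAlgorithm n m Out} {correct : SetSystem n m → Out → Prop}
    (hA : SolvesWithProb μ A correct (2 / 3)) {I₀ : SetSystem n m} (h₀ : ∃ C, I₀.IsCover C)
    {I : X → SetSystem n m} (hI : ∀ x, ∃ C, (I x).IsCover C)
    (hdisj : ∀ x o, correct I₀ o → ¬ correct (I x) o) {B T : ℝ} (hB : 0 ≤ B)
    (helt : ∀ (S : Fin m) (j : ℕ),
      (Nat.card {x // ((I x).elts S)[j]? ≠ (I₀.elts S)[j]?} : ℝ) ≤ B)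
    (hset : ∀ (e : Fin n) (j : ℕ),
      (Nat.card {x // ((I x).sets e)[j]? ≠ (I₀.sets e)[j]?} : ℝ) ≤ B)
    (hT : T * B ≤ Fintype.card X / 4) :
    ∃ x, 0 < μ {ω | T ≤ ((A ω).queries (I x) : ℝ)} := by
  classical
  by_contra! hcon
  have hX : (0 : ℝ) < Fintype.card X := by exact_mod_cast Fintype.card_pos
  have hae : ∀ᵐ ω ∂μ, ∀ x, ((A ω).queries (I x) : ℝ) < T := by
    rw [ae_all_iff]
    intro x
    have h := hcon x
    rw [nonpos_iff_eq_zero] at h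
    rw [ae_iff]
    simpa only [not_lt] using h
  set G : X → Set Ω := fun x => {ω | correct (I x) ((A ω).run (I x))} ∩
    {ω | correct I₀ ((A ω).run I₀)} with hG
  have hGm : ∀ x, MeasurableSet (G x) := fun x => (hA _ (hI x)).1.inter (hA _ h₀).1
  have hGμ : ∀ x, 1 / 3 ≤ μ.real (G x) := by
    intro x
    have h1 := (hA _ (hI x)).2
    have h2 := (hA _ h₀).2
    have h3 := measureReal_union_add_inter (μ := μ)
      (s := {ω | correct (I x) ((A ω).run (I x))}) (hA _ h₀).1
    have h4 : μ.real ({ω | correct (I x) ((A ω).run (I x))} ∪ {ω | correct I₀ ((A ω).run I₀)}) ≤ 1 :=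
      measureReal_le_one
    simp only [hG]
    linarith
  -- almost surely, the runs on `I₀` and on `I x` are both correct for at most a quarter of the `x`
  have hle : ∀ᵐ ω ∂μ, ∑ x, (G x).indicator (fun _ => (1 : ℝ)) ω ≤ Fintype.card X / 4 := by
    filter_upwards [hae] with ω hω
    have hT0 : 0 < T := lt_of_le_of_lt (Nat.cast_nonneg _) (hω (Classical.arbitrary X))
    have hq : ∀ x, (A ω).queries (I x) ≤ ⌈T⌉₊ - 1 := fun x =>
      Nat.le_sub_one_of_lt (Nat.lt_ceil.2 (hω x))
    have hqT : ((⌈T⌉₊ - 1 : ℕ) : ℝ) ≤ T := by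
      have h1 : 1 ≤ ⌈T⌉₊ := Nat.one_le_ceil_iff.2 hT0
      have h2 := Nat.ceil_lt_add_one hT0.le
      push_cast [h1]
      linarith
    have h := card_filter_run_ne_le I₀ I hB helt hset (A ω) (⌈T⌉₊ - 1)
    refine le_trans ?_ ((h.trans (mul_le_mul_of_nonneg_right hqT hB)).trans hT)
    have hind : ∀ x, (G x).indicator (fun _ => (1 : ℝ)) ω = if ω ∈ G x then 1 else 0 := fun x => by
      simp [Set.indicator_apply]
    rw [Finset.sum_congr rfl fun x _ => hind x, Finset.sum_boole, Nat.card_eq_fintype_card,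
      Fintype.card_subtype]
    refine Nat.cast_le.2 (Finset.card_le_card fun x => ?_)
    simp only [Finset.mem_filter, Finset.mem_univ, true_and, hG]
    rintro ⟨h1, h2⟩
    refine ⟨hq x, fun h3 => hdisj x _ h2 ?_⟩
    rw [← h3]
    exact h1
  have hint : ∀ x ∈ Finset.univ, Integrable ((G x).indicator (fun _ => (1 : ℝ))) μ :=
    fun x _ => (integrable_const 1).indicator (hGm x)
  have h5 : ∫ ω, ∑ x, (G x).indicator (fun _ => (1 : ℝ)) ω ∂μ ≤ ∫ _, (Fintype.card X / 4 : ℝ) ∂μ :=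
    integral_mono_ae (integrable_finsetSum _ hint) (integrable_const _) hle
  rw [integral_finsetSum _ hint] at h5
  have h6 : ∀ x, ∫ ω, (G x).indicator (fun _ => (1 : ℝ)) ω ∂μ = μ.real (G x) := by
    intro x
    rw [integral_indicator_const _ (hGm x)]
    simp
  simp only [h6, integral_const, probReal_univ, one_smul] at h5
  have h7 : ∑ _x : X, (1 / 3 : ℝ) ≤ ∑ x, μ.real (G x) := Finset.sum_le_sum fun x _ => hGμ x
  simp only [Finset.sum_const, Finset.card_univ, nsmul_eq_mul] at h7
  linarith

end QueryAlgorithm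

/-! ### Permuting the lists of a set system -/

namespace SetSystem

/-- The set system in which, up to the identifications `a` and `b`, the set `S` lists the elements
`σ S x` for `x` incident to `S`, and the element `x` lies in the sets `τ x S` for `S` incident
to `x`. The positions in the lists do not depend on `σ` and `τ`. -/
noncomputable def ofIncidence {n m : ℕ} {El St : Type*} (a : Fin n ≃ El) (b : Fin m ≃ St)
    (inc : St → El → Prop) (σ : St → Equiv.Perm El) (τ : El → Equiv.Perm St)
    (h : ∀ S x, inc S ((σ S).symm x) ↔ inc ((τ x).symm S) x) : SetSystem n m where
  elts S := open Classical in
    ((List.finRange n).filter (fun e => inc (b S) (a e))).map fun e => a.symm (σ (b S) (a e))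
  sets e := open Classical in
    ((List.finRange m).filter (fun S => inc (b S) (a e))).map fun S => b.symm (τ (a e) (b S))
  elts_nodup S := (List.Nodup.filter _ (List.nodup_finRange n)).map fun x y hxy => by simpa using hxy
  sets_nodup e := (List.Nodup.filter _ (List.nodup_finRange m)).map fun x y hxy => by simpa using hxy
  mem_iff S e := by
    have h1 : (∃ x, inc (b S) (a x) ∧ a.symm (σ (b S) (a x)) = e) ↔
        inc (b S) ((σ (b S)).symm (a e)) := by
      constructor
      · rintro ⟨x, hx, rfl⟩; simpa using hx
      · intro hx; exact ⟨a.symm ((σ (b S)).symm (a e)), by simpa using hx, by simp⟩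
    have h2 : (∃ x, inc (b x) (a e) ∧ b.symm (τ (a e) (b x)) = S) ↔
        inc ((τ (a e)).symm (b S)) (a e) := by
      constructor
      · rintro ⟨x, hx, rfl⟩; simpa using hx
      · intro hx; exact ⟨b.symm ((τ (a e)).symm (b S)), by simpa using hx, by simp⟩
    simp only [List.mem_map, List.mem_filter, List.mem_finRange, true_and, decide_eq_true_eq]
    rw [h1, h2, h]

section ofIncidence

variable {n m : ℕ} {El St : Type*} {a : Fin n ≃ El} {b : Fin m ≃ St} {inc : St → El → Prop}
  {σ : St → Equiv.Perm El} {τ : El → Equiv.Perm St}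

theorem mem_elts_ofIncidence (h : ∀ S x, inc S ((σ S).symm x) ↔ inc ((τ x).symm S) x)
    {S : Fin m} {e : Fin n} :
    e ∈ (ofIncidence a b inc σ τ h).elts S ↔ inc (b S) ((σ (b S)).symm (a e)) := by
  simp only [ofIncidence, List.mem_map, List.mem_filter, List.mem_finRange, true_and,
    decide_eq_true_eq]
  constructor
  · rintro ⟨x, hx, rfl⟩; simpa using hx
  · intro hx; exact ⟨a.symm ((σ (b S)).symm (a e)), by simpa using hx, by simp⟩

variable {X : Type*} [Fintype X] {σ : X → St → Equiv.Perm El} {τ : X → El → Equiv.Perm St}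

/-- The answer to a query about a set is affected only by the displacement of one
incidence, the same for all choices of `σ`. -/
theorem card_elts_ofIncidence_ne_le
    (h : ∀ i S x, inc S ((σ i S).symm x) ↔ inc ((τ i x).symm S) x)
    (h₀ : ∀ S x, inc S ((1 : Equiv.Perm El).symm x) ↔ inc ((1 : Equiv.Perm St).symm S) x)
    {B : ℝ} (hB : 0 ≤ B) (hc : ∀ S x, inc S x → (Nat.card {i // σ i S x ≠ x} : ℝ) ≤ B)
    (S : Fin m) (j : ℕ) :
    (Nat.card {i // ((ofIncidence a b inc (σ i) (τ i) (h i)).elts S)[j]? ≠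
      ((ofIncidence a b inc (fun _ => 1) (fun _ => 1) h₀).elts S)[j]?} : ℝ) ≤ B := by
  classical
  rcases hp : ((List.finRange n).filter (fun e => inc (b S) (a e)))[j]? with _ | e
  · simpa [ofIncidence, hp] using hB
  · have he : inc (b S) (a e) := by simpa using List.mem_of_getElem? hp
    refine le_trans (le_of_eq ?_) (hc _ _ he)
    congr 1
    refine Nat.card_congr (Equiv.subtypeEquivRight fun i => ?_)
    simp [ofIncidence, hp, Equiv.symm_apply_eq]

/-- The analogue of `card_elts_ofIncidence_ne_le` for queries about elements. -/
theorem card_sets_ofIncidence_ne_le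
    (h : ∀ i S x, inc S ((σ i S).symm x) ↔ inc ((τ i x).symm S) x)
    (h₀ : ∀ S x, inc S ((1 : Equiv.Perm El).symm x) ↔ inc ((1 : Equiv.Perm St).symm S) x)
    {B : ℝ} (hB : 0 ≤ B) (hc : ∀ S x, inc S x → (Nat.card {i // τ i x S ≠ S} : ℝ) ≤ B)
    (e : Fin n) (j : ℕ) :
    (Nat.card {i // ((ofIncidence a b inc (σ i) (τ i) (h i)).sets e)[j]? ≠
      ((ofIncidence a b inc (fun _ => 1) (fun _ => 1) h₀).sets e)[j]?} : ℝ) ≤ B := by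
  classical
  rcases hp : ((List.finRange m).filter (fun S => inc (b S) (a e)))[j]? with _ | S
  · simpa [ofIncidence, hp] using hB
  · have he : inc (b S) (a e) := by simpa using List.mem_of_getElem? hp
    refine le_trans (le_of_eq ?_) (hc _ _ he)
    congr 1
    refine Nat.card_congr (Equiv.subtypeEquivRight fun i => ?_)
    simp [ofIncidence, hp, Equiv.symm_apply_eq]

end ofIncidence
end SetSystem

section exchange

variable {E F St : Type*} [DecidableEq E] [DecidableEq St]

open scoped Classical in
/-- The involution of `E ⊕ F` that exchanges `e` with `φ e` for `e ∈ V`. -/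
noncomputable def exchange (φ : E ↪ F) (V : Finset E) : Equiv.Perm (E ⊕ F) :=
  Function.Involutive.toPerm
    (Sum.elim (fun e => if e ∈ V then .inr (φ e) else .inl e)
      (fun f => if h : ∃ e ∈ V, φ e = f then .inl h.choose else .inr f)) (by
    have key : ∀ e ∈ V, ∀ h : ∃ e' ∈ V, φ e' = φ e, h.choose = e := fun e _ h =>
      φ.injective h.choose_spec.2
    rintro (e | f)
    · by_cases he : e ∈ V
      · have h : ∃ e' ∈ V, φ e' = φ e := ⟨e, he, rfl⟩
        simp only [Sum.elim_inl, if_pos he, Sum.elim_inr, dif_pos h, key e he h]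
      · simp [he]
    · by_cases h : ∃ e ∈ V, φ e = f
      · simp only [Sum.elim_inr, dif_pos h, Sum.elim_inl, if_pos h.choose_spec.1,
          h.choose_spec.2]
      · simp only [Sum.elim_inr, dif_neg h])

theorem exchange_symm (φ : E ↪ F) (V : Finset E) : (exchange φ V).symm = exchange φ V := rfl

theorem exchange_inl_of_mem (φ : E ↪ F) {V : Finset E} {e : E} (he : e ∈ V) :
    exchange φ V (.inl e) = .inr (φ e) :=
  if_pos he

theorem exchange_inl_of_notMem (φ : E ↪ F) {V : Finset E} {e : E} (he : e ∉ V) :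
    exchange φ V (.inl e) = .inl e :=
  if_neg he

theorem exchange_inr_of_mem (φ : E ↪ F) {V : Finset E} {e : E} (he : e ∈ V) :
    exchange φ V (.inr (φ e)) = .inl e := by
  rw [← exchange_inl_of_mem φ he, ← Equiv.eq_symm_apply, exchange_symm]

theorem exchange_inr_of_forall (φ : E ↪ F) {V : Finset E} {f : F} (hf : ∀ e ∈ V, φ e ≠ f) :
    exchange φ V (.inr f) = .inr f :=
  dif_neg (by push Not; exact hf)

/-- For the sets, the exchange that makes `S₀` contain all of `U`: in `S₀`, each `φ e` with `e ∈ U`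
is replaced by `e`, and in the set `ψ e` the element `e` is replaced by `φ e`. -/
noncomputable def setExchange (φ : E ↪ F) (U : Finset E) (S₀ : St) (ψ : E → St) (S : St) :
    Equiv.Perm (E ⊕ F) :=
  exchange φ (U.filter fun e => S = S₀ ∨ S = ψ e)

open Classical in
/-- The effect of `setExchange` on the lists of sets of the elements: for `e ∈ U`, the sets `S₀` and
`ψ e` change places in the lists of `e` and of `φ e`. -/
noncomputable def elementExchange (φ : E ↪ F) (U : Finset E) (S₀ : St) (ψ : E → St) :
    E ⊕ F → Equiv.Perm St :=
  Sum.elim (fun e => if e ∈ U then Equiv.swap S₀ (ψ e) else 1)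
    (fun f => if h : ∃ e ∈ U, φ e = f then Equiv.swap S₀ (ψ h.choose) else 1)

variable {φ : E ↪ F} {U : Finset E} {S₀ : St} {ψ : E → St}

theorem elementExchange_inl_of_mem {e : E} (he : e ∈ U) :
    elementExchange φ U S₀ ψ (.inl e) = Equiv.swap S₀ (ψ e) := by
  simp [elementExchange, he]

theorem elementExchange_inl_of_notMem {e : E} (he : e ∉ U) :
    elementExchange φ U S₀ ψ (.inl e) = 1 := by
  simp [elementExchange, he]

theorem elementExchange_inr_of_mem {e : E} (he : e ∈ U) :
    elementExchange φ U S₀ ψ (.inr (φ e)) = Equiv.swap S₀ (ψ e) := by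
  have h : ∃ e' ∈ U, φ e' = φ e := ⟨e, he, rfl⟩
  have h' : h.choose = e := φ.injective h.choose_spec.2
  simp only [elementExchange, Sum.elim_inr, dif_pos h, h']

theorem elementExchange_inr_of_forall {f : F} (hf : ∀ e ∈ U, φ e ≠ f) :
    elementExchange φ U S₀ ψ (.inr f) = 1 := by
  have : ¬ ∃ e ∈ U, φ e = f := by push Not; exact hf
  simp only [elementExchange, Sum.elim_inr, dif_neg this]

variable {inc : St → E ⊕ F → Prop}

/-- The two sides of an exchange describe the same modified incidence relation. -/
theorem exchange_compatible (h1 : ∀ e ∈ U, ¬ inc S₀ (.inl e)) (h2 : ∀ e ∈ U, inc S₀ (.inr (φ e)))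
    (h3 : ∀ e ∈ U, inc (ψ e) (.inl e)) (h4 : ∀ e ∈ U, ¬ inc (ψ e) (.inr (φ e)))
    (S : St) (x : E ⊕ F) :
    inc S ((setExchange φ U S₀ ψ S).symm x) ↔ inc ((elementExchange φ U S₀ ψ x).symm S) x := by
  rw [setExchange, exchange_symm]
  have swap : ∀ e ∈ U, (inc S (exchange φ (U.filter fun e => S = S₀ ∨ S = ψ e) (.inl e)) ↔
      inc (Equiv.swap S₀ (ψ e) S) (.inl e)) ∧
      (inc S (exchange φ (U.filter fun e => S = S₀ ∨ S = ψ e) (.inr (φ e))) ↔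
      inc (Equiv.swap S₀ (ψ e) S) (.inr (φ e))) := by
    intro e he
    by_cases hS : S = S₀ ∨ S = ψ e
    · have hV : e ∈ U.filter fun e => S = S₀ ∨ S = ψ e := by simp [he, hS]
      rw [exchange_inl_of_mem φ hV, exchange_inr_of_mem φ hV]
      rcases hS with rfl | rfl
      · simp [h1 e he, h2 e he, h3 e he, h4 e he]
      · simp [h1 e he, h2 e he, h3 e he, h4 e he]
    · have hV : e ∉ U.filter fun e => S = S₀ ∨ S = ψ e := by simp [he, hS]
      have hV' : ∀ e' ∈ U.filter (fun e => S = S₀ ∨ S = ψ e), φ e' ≠ φ e := by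
        intro e' he' h
        rw [φ.injective h] at he'
        exact hV he'
      push Not at hS
      rw [exchange_inl_of_notMem φ hV, exchange_inr_of_forall φ hV',
        Equiv.swap_apply_of_ne_of_ne hS.1 hS.2]
      simp
  rcases x with e | f
  · by_cases he : e ∈ U
    · rw [elementExchange_inl_of_mem he, Equiv.symm_swap]
      exact (swap e he).1
    · rw [elementExchange_inl_of_notMem he, exchange_inl_of_notMem φ (by simp [he])]
      rfl
  · by_cases hf : ∃ e ∈ U, φ e = f
    · obtain ⟨e, he, rfl⟩ := hf
      rw [elementExchange_inr_of_mem he, Equiv.symm_swap]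
      exact (swap e he).2
    · push Not at hf
      rw [elementExchange_inr_of_forall hf,
        exchange_inr_of_forall φ fun e he => hf e (Finset.mem_filter.1 he).1]
      rfl

/-- The incidences that an exchange displaces are those of `S₀` with `φ e` and of `ψ e` with `e`. -/
theorem of_setExchange_ne (h1 : ∀ e ∈ U, ¬ inc S₀ (.inl e))
    (h4 : ∀ e ∈ U, ¬ inc (ψ e) (.inr (φ e))) {S : St} {x : E ⊕ F} (hS : inc S x)
    (h : setExchange φ U S₀ ψ S x ≠ x) :
    (∃ e ∈ U, S = S₀ ∧ x = .inr (φ e)) ∨ ∃ e ∈ U, S = ψ e ∧ x = .inl e := by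
  rcases x with e | f
  · right
    by_cases he : e ∈ U.filter fun e => S = S₀ ∨ S = ψ e
    · rw [Finset.mem_filter] at he
      rcases he with ⟨he, rfl | rfl⟩
      · exact absurd hS (h1 e he)
      · exact ⟨e, he, rfl, rfl⟩
    · exact absurd (exchange_inl_of_notMem φ he) h
  · left
    by_cases hf : ∃ e ∈ U.filter (fun e => S = S₀ ∨ S = ψ e), φ e = f
    · obtain ⟨e, he, rfl⟩ := hf
      rw [Finset.mem_filter] at he
      rcases he with ⟨he, rfl | rfl⟩
      · exact ⟨e, he, rfl, rfl⟩
      · exact absurd hS (h4 e he)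
    · push Not at hf
      exact absurd (exchange_inr_of_forall φ hf) h

theorem of_elementExchange_ne (h1 : ∀ e ∈ U, ¬ inc S₀ (.inl e))
    (h4 : ∀ e ∈ U, ¬ inc (ψ e) (.inr (φ e))) {S : St} {x : E ⊕ F} (hS : inc S x)
    (h : elementExchange φ U S₀ ψ x S ≠ S) :
    (∃ e ∈ U, S = S₀ ∧ x = .inr (φ e)) ∨ ∃ e ∈ U, S = ψ e ∧ x = .inl e := by
  have of_swap : ∀ {e : E}, Equiv.swap S₀ (ψ e) S ≠ S → S = S₀ ∨ S = ψ e := by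
    intro e h
    by_contra! hS
    exact h (Equiv.swap_apply_of_ne_of_ne hS.1 hS.2)
  rcases x with e | f
  · right
    by_cases he : e ∈ U
    · rw [elementExchange_inl_of_mem he] at h
      rcases of_swap h with rfl | rfl
      · exact absurd hS (h1 e he)
      · exact ⟨e, he, rfl, rfl⟩
    · exact absurd (by rw [elementExchange_inl_of_notMem he]; rfl) h
  · left
    by_cases hf : ∃ e ∈ U, φ e = f
    · obtain ⟨e, he, rfl⟩ := hf
      rw [elementExchange_inr_of_mem he] at h
      rcases of_swap h with rfl | rfl
      · exact ⟨e, he, rfl, rfl⟩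
      · exact absurd hS (h4 e he)
    · push Not at hf
      exact absurd (by rw [elementExchange_inr_of_forall hf]; rfl) h

end exchange

/-! ### Covering designs -/

/-- The probability that a random `z`-subset of `Fin D` contains a given `a`-subset. -/
theorem pow_div_mul_choose_le {D z a : ℕ} (haz : a ≤ z) (hzD : z ≤ D) :
    ((z - a : ℝ) / D) ^ a * D.choose z ≤ (D - a).choose (z - a) := by
  rcases Nat.eq_zero_or_pos D with rfl | hD
  · obtain rfl : z = 0 := by omega
    obtain rfl : a = 0 := by omega
    simp
  have h1 : (z - a) ^ a ≤ z.descFactorial a :=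
    (Nat.pow_le_pow_left (by omega) a).trans (Nat.pow_sub_le_descFactorial z a)
  have h2 : D.descFactorial a ≤ D ^ a := Nat.descFactorial_le_pow D a
  have h3 : D.descFactorial a * (D - a).choose (z - a) = z.descFactorial a * D.choose z := by
    rw [Nat.descFactorial_eq_factorial_mul_choose, Nat.descFactorial_eq_factorial_mul_choose,
      mul_assoc, ← Nat.choose_mul haz]
    ring
  have h4 : (z - a) ^ a * D.choose z ≤ D ^ a * (D - a).choose (z - a) :=
    (Nat.mul_le_mul_right _ h1).trans (h3 ▸ Nat.mul_le_mul_right _ h2)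
  have h5 : ((z - a : ℝ)) ^ a * D.choose z ≤ (D : ℝ) ^ a * (D - a).choose (z - a) := by
    rw [← Nat.cast_sub haz]
    exact_mod_cast h4
  rw [div_pow, div_mul_eq_mul_div, div_le_iff₀ (by positivity)]
  linarith

/-- A covering design with `N` blocks exists if `N` random `z`-subsets of `Fin D` are likely
enough to contain any given `a`-subset for a union bound over all `a`-subsets. -/
theorem exists_coveringDesign {D z a N : ℕ} (haz : a ≤ z) (hzD : z ≤ D) (hD : 0 < D)
    (hN : a * Real.log D < N * ((z - a : ℝ) / D) ^ a) :
    ∃ Z : Fin N → Finset (Fin D), (∀ e, (Z e).card = z) ∧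
      ∀ A : Finset (Fin D), A.card ≤ a → ∃ e, A ⊆ Z e := by
  classical
  by_contra! hcon
  set P := (Finset.univ : Finset (Fin D)).powersetCard z with hP
  have hPc : P.card = D.choose z := by simp [hP]
  set ρ : ℝ := ((z - a : ℝ) / D) ^ a
  have hsub : Fintype.piFinset (fun _ : Fin N => P) ⊆
      ((Finset.univ : Finset (Fin D)).powersetCard a).biUnion fun A =>
        Fintype.piFinset fun _ : Fin N => P.filter fun Y => ¬ A ⊆ Y := by
    intro Z hZ
    rw [Fintype.mem_piFinset] at hZ
    obtain ⟨A, hA, hAZ⟩ := hcon Z fun e => (Finset.mem_powersetCard.1 (hZ e)).2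
    obtain ⟨A', hAA', -, hA'⟩ := Finset.exists_subsuperset_card_eq (Finset.subset_univ A) hA
      (by simpa using haz.trans hzD)
    simp only [Finset.mem_biUnion, Finset.mem_powersetCard, Fintype.mem_piFinset,
      Finset.mem_filter]
    exact ⟨A', ⟨Finset.subset_univ _, hA'⟩, fun e => ⟨hZ e, fun h => hAZ e (hAA'.trans h)⟩⟩
  have hbad : ∀ A ∈ (Finset.univ : Finset (Fin D)).powersetCard a,
      ((P.filter fun Y => ¬ A ⊆ Y).card : ℝ) ≤ D.choose z * Real.exp (-ρ) := by
    intro A hA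
    have hAc := (Finset.mem_powersetCard.1 hA).2
    have h1 := Finset.card_filter_add_card_filter_not (s := P) fun Y => A ⊆ Y
    rw [hPc, hP, Finset.card_filter_powersetCard_subset _ _ _ (Finset.subset_univ _)
      (by omega), ← hP, hAc, Finset.card_univ, Fintype.card_fin] at h1
    have h2 := pow_div_mul_choose_le haz hzD
    have h3 : (1 - ρ) ≤ Real.exp (-ρ) := by linarith [Real.add_one_le_exp (-ρ)]
    have h4 : (((D - a).choose (z - a) : ℕ) : ℝ) + ((P.filter fun Y => ¬ A ⊆ Y).card : ℝ) =
      D.choose z := by exact_mod_cast h1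
    nlinarith [Nat.cast_nonneg (α := ℝ) (D.choose z)]
  have hC : (0 : ℝ) < D.choose z := by exact_mod_cast Nat.choose_pos hzD
  have hD' : (0 : ℝ) < D := by exact_mod_cast hD
  have h5 : ((D.choose z : ℝ)) ^ N ≤ D ^ a * (D.choose z * Real.exp (-ρ)) ^ N := by
    have h := (Finset.card_le_card hsub).trans Finset.card_biUnion_le
    simp only [Fintype.card_piFinset, Finset.prod_const, Finset.card_univ, Fintype.card_fin,
      hPc] at h
    have h' : ((D.choose z : ℝ)) ^ N ≤ ∑ A ∈ (Finset.univ : Finset (Fin D)).powersetCard a,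
      ((P.filter fun Y => ¬ A ⊆ Y).card : ℝ) ^ N := by exact_mod_cast h
    refine (h'.trans (Finset.sum_le_sum fun A hA =>
      pow_le_pow_left₀ (Nat.cast_nonneg _) (hbad A hA) N)).trans ?_
    rw [Finset.sum_const, nsmul_eq_mul, Finset.card_powersetCard, Finset.card_univ,
      Fintype.card_fin]
    refine mul_le_mul_of_nonneg_right ?_ (by positivity)
    exact_mod_cast Nat.choose_le_pow D a
  rw [mul_pow, ← Real.exp_nat_mul, ← Real.exp_log hD', ← Real.exp_nat_mul,
    mul_left_comm, ← Real.exp_add] at h5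
  have h6 : Real.exp (a * Real.log D + N * -ρ) < 1 := by
    rw [Real.exp_lt_one_iff]; linarith
  have h7 : (0 : ℝ) < (D.choose z : ℝ) ^ N := by positivity
  nlinarith

/-! ### Displaced incidences -/

namespace HardInstance

/-- The elements of the hard instances: `E` are the main elements, `F` are fillers to exchange with
main elements, and `Option κ` are markers that make every cover contain a set of each of
`|κ| + 1` kinds. -/
abbrev Element (E F κ : Type) := E ⊕ (F ⊕ Option κ)

/-- The sets of the hard instances, each of a type in `Ty` that determines its main elements: `M` head
sets per type, `M` partner sets per type, for every `i : κ` one set per type, and empty sets. -/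
abbrev Family (Ty κ R : Type) (M : ℕ) := (Ty × Fin M) ⊕ (Ty × Fin M) ⊕ (κ × Ty) ⊕ R

variable {E F κ Ty R : Type} {M w : ℕ}

/-- The incidences of the unmodified instance, where `Z e` consists of the types that avoid `e`. -/
def Incident (Z : E → Finset Ty) : Family Ty κ R M → Element E F κ → Prop
  | .inl s, .inl e => s.1 ∉ Z e
  | .inl _, .inr (.inl _) => True
  | .inl _, .inr (.inr o) => o = none
  | .inr (.inl s), .inl e => s.1 ∉ Z e
  | .inr (.inr (.inl s)), .inl e => s.2 ∉ Z e
  | .inr (.inr (.inl _)), .inr (.inl _) => True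
  | .inr (.inr (.inl s)), .inr (.inr o) => o = some s.1
  | _, _ => False

variable [Fintype E] [Fintype κ] [DecidableEq Ty]

/-- The main elements that are avoided by all types in `s`. -/
def uncovered (Z : E → Finset Ty) (s : Ty × (κ → Ty)) : Finset E :=
  Finset.univ.filter fun e => s.1 ∈ Z e ∧ ∀ i, s.2 i ∈ Z e

theorem mem_uncovered {Z : E → Finset Ty} {s : Ty × (κ → Ty)} {e : E} :
    e ∈ uncovered Z s ↔ s.1 ∈ Z e ∧ ∀ i, s.2 i ∈ Z e := by
  simp [uncovered]

variable [Fintype Ty]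

/-- The choices of types that leave at most twice as many main elements uncovered as the average
choice does, where `z` is the size of all `Z e`. With this restriction, whatever the type of the
head set, the other types do not leave too many elements to exchange with it. -/
abbrev GoodTypes (κ : Type) [Fintype κ] (Z : E → Finset Ty) (z : ℕ) :=
  {s : Ty × (κ → Ty) // (uncovered Z s).card * Fintype.card Ty ^ (Fintype.card κ + 1) ≤
    2 * (Fintype.card E * z ^ (Fintype.card κ + 1))}

/-- A choice of a modified instance: the types of the hidden cover, the index of its head set, the
shift that matches main elements with fillers, and the choice of the partner sets. -/
abbrev Seed (κ F : Type) [Fintype κ] (Z : E → Finset Ty) (z M w : ℕ) :=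
  GoodTypes κ Z z × Fin M × F × (Fin w × Fin M)

section counting

variable [Fintype F] [DecidableEq κ] {Z : E → Finset Ty} {z : ℕ}

theorem card_seed : Fintype.card (Seed κ F Z z M w) =
    Fintype.card (GoodTypes κ Z z) * (M * (Fintype.card F * (w * M))) := by
  simp [Seed, Fintype.card_prod, Fintype.card_fin]

variable [DecidableEq E]

theorem card_mem_uncovered (hZ : ∀ e, (Z e).card = z) (e : E) :
    (Finset.univ.filter fun s : Ty × (κ → Ty) => e ∈ uncovered Z s).card =
      z ^ (Fintype.card κ + 1) := by
  have : (Finset.univ.filter fun s : Ty × (κ → Ty) => e ∈ uncovered Z s) =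
      Z e ×ˢ Fintype.piFinset fun _ : κ => Z e := by
    ext s
    simp [mem_uncovered]
  rw [this, Finset.card_product, Fintype.card_piFinset, Finset.prod_const, hZ, Finset.card_univ,
    pow_succ']

/-- Markov's inequality for the number of uncovered elements. -/
theorem le_two_mul_card_goodTypes (hZ : ∀ e, (Z e).card = z) :
    Fintype.card Ty ^ (Fintype.card κ + 1) ≤ 2 * Fintype.card (GoodTypes κ Z z) := by
  set N := Fintype.card E * z ^ (Fintype.card κ + 1) with hN
  set K := Fintype.card Ty ^ (Fintype.card κ + 1) with hK
  have hsum : ∑ s : Ty × (κ → Ty), (uncovered Z s).card = N := by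
    have h := Finset.sum_card_bipartiteAbove_eq_sum_card_bipartiteBelow
      (s := (Finset.univ : Finset (Ty × (κ → Ty)))) (t := (Finset.univ : Finset E))
      (fun s e => e ∈ uncovered Z s)
    simp only [Finset.bipartiteAbove, Finset.bipartiteBelow, card_mem_uncovered hZ,
      Finset.filter_univ_mem, Finset.sum_const, Finset.card_univ, smul_eq_mul] at h
    exact h
  rw [Fintype.card_subtype]
  set p : Ty × (κ → Ty) → Prop := fun s => (uncovered Z s).card * K ≤ 2 * N
  have h1 := Finset.card_filter_add_card_filter_not (s := Finset.univ) p
  have hcard : (Finset.univ : Finset (Ty × (κ → Ty))).card = K := by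
    simp [hK, pow_succ']
  have h2 : (Finset.univ.filter fun s => ¬ p s).card * (2 * N + 1) ≤ N * K := by
    conv_rhs => rw [← hsum, Finset.sum_mul]
    rw [← smul_eq_mul]
    refine (Finset.card_nsmul_le_sum _ (fun s => (uncovered Z s).card * K) _ fun s hs => ?_).trans
      (Finset.sum_le_sum_of_subset (Finset.filter_subset _ _))
    exact not_le.1 (Finset.mem_filter.1 hs).2
  have h3 : 2 * (Finset.univ.filter fun s => ¬ p s).card ≤ K := by
    by_contra! h
    nlinarith
  change K ≤ 2 * (Finset.univ.filter p).card
  omega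

/-- Few seeds displace a given incidence of a partner set with a main element. -/
theorem card_displaced_main (hZ : ∀ e, (Z e).card = z) (comp : E → Fin w ↪ Ty)
    (e : E) (t : Ty) (c : Fin M) :
    (Finset.univ.filter fun i : Seed κ F Z z M w => e ∈ uncovered Z i.1.1 ∧
      comp e i.2.2.2.1 = t ∧ i.2.2.2.2 = c).card * (w * M) *
        Fintype.card Ty ^ (Fintype.card κ + 1) ≤
      4 * z ^ (Fintype.card κ + 1) * Fintype.card (Seed κ F Z z M w) := by
  have h1 : (Finset.univ.filter fun i : Seed κ F Z z M w => e ∈ uncovered Z i.1.1 ∧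
      comp e i.2.2.2.1 = t ∧ i.2.2.2.2 = c).card ≤
      z ^ (Fintype.card κ + 1) * (M * Fintype.card F) := by
    have := Finset.card_le_card_of_injOn
      (s := Finset.univ.filter fun i : Seed κ F Z z M w => e ∈ uncovered Z i.1.1 ∧
        comp e i.2.2.2.1 = t ∧ i.2.2.2.2 = c)
      (t := (Finset.univ.filter fun s : Ty × (κ → Ty) => e ∈ uncovered Z s) ×ˢ
        (Finset.univ : Finset (Fin M × F)))
      (fun i => (i.1.1, i.2.1, i.2.2.1)) (by
        intro i hi
        simp only [Finset.coe_filter, Finset.mem_univ, true_and, Set.mem_ofPred_eq] at hi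
        simpa using hi.1) (by
        rintro ⟨s, c₁, r, y, d⟩ hi ⟨s', c₁', r', y', d'⟩ hi' h
        simp only [Finset.coe_filter, Finset.mem_univ, true_and, Set.mem_ofPred_eq] at hi hi'
        simp only [Prod.mk.injEq] at h ⊢
        exact ⟨Subtype.ext h.1, h.2.1, h.2.2, (comp e).injective (hi.2.1.trans hi'.2.1.symm),
          hi.2.2.trans hi'.2.2.symm⟩)
    rw [Finset.card_product, card_mem_uncovered hZ] at this
    simpa using this
  have h3 := le_two_mul_card_goodTypes (κ := κ) hZ
  rw [card_seed]
  calc _ ≤ z ^ (Fintype.card κ + 1) * (M * Fintype.card F) * (w * M) *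
        (2 * Fintype.card (GoodTypes κ Z z)) := by gcongr
    _ ≤ 2 * (z ^ (Fintype.card κ + 1) * (M * Fintype.card F) * (w * M) *
        (2 * Fintype.card (GoodTypes κ Z z))) := by omega
    _ = _ := by ring

variable [AddCommGroup F] [DecidableEq F]

/-- Few seeds displace a given incidence of a head set with a filler. -/
theorem card_displaced_filler (hZ : ∀ e, (Z e).card = z) (hw : w ≤ Fintype.card Ty)
    (hEF : Fintype.card E ≤ Fintype.card F) (ι : E ↪ F) (t : Ty) (c : Fin M) (f : F) :
    (Finset.univ.filter fun i : Seed κ F Z z M w => i.1.1.1 = t ∧ i.2.1 = c ∧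
      ∃ e ∈ uncovered Z i.1.1, ι e + i.2.2.1 = f).card * (w * M) *
        Fintype.card Ty ^ (Fintype.card κ + 1) ≤
      4 * z ^ (Fintype.card κ + 1) * Fintype.card (Seed κ F Z z M w) := by
  set K := Fintype.card Ty ^ (Fintype.card κ + 1) with hK
  set G : Finset (GoodTypes κ Z z) := Finset.univ.filter fun s => s.1.1 = t with hG
  have h1 : (Finset.univ.filter fun i : Seed κ F Z z M w => i.1.1.1 = t ∧ i.2.1 = c ∧
      ∃ e ∈ uncovered Z i.1.1, ι e + i.2.2.1 = f).card ≤
      (∑ s ∈ G, (uncovered Z s.1).card) * (w * M) := by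
    have hsub : (Finset.univ.filter fun i : Seed κ F Z z M w => i.1.1.1 = t ∧ i.2.1 = c ∧
        ∃ e ∈ uncovered Z i.1.1, ι e + i.2.2.1 = f) ⊆
        ((G.sigma fun s => uncovered Z s.1) ×ˢ (Finset.univ : Finset (Fin w × Fin M))).image
          fun p => (p.1.1, c, f - ι p.1.2, p.2) := by
      rintro ⟨s, c', r, y⟩ hi
      simp only [Finset.mem_filter, Finset.mem_univ, true_and] at hi
      obtain ⟨rfl, rfl, e, he, rfl⟩ := hi
      rw [Finset.mem_image]
      refine ⟨(⟨s, e⟩, y), ?_, by simp⟩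
      simpa [hG] using he
    refine (Finset.card_le_card hsub).trans (Finset.card_image_le.trans (le_of_eq ?_))
    rw [Finset.card_product, Finset.card_sigma]
    simp
  have h2 : (∑ s ∈ G, (uncovered Z s.1).card) * K ≤ Fintype.card Ty ^ Fintype.card κ *
      (2 * (Fintype.card E * z ^ (Fintype.card κ + 1))) := by
    have hGc : G.card ≤ Fintype.card Ty ^ Fintype.card κ := by
      have := Finset.card_le_card_of_injOn (s := G) (t := (Finset.univ : Finset (κ → Ty)))
        (fun s => s.1.2) (fun _ _ => Finset.mem_univ _) (by
          intro s hs s' hs' h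
          simp only [hG, Finset.coe_filter, Finset.mem_univ, true_and, Set.mem_ofPred_eq] at hs hs'
          exact Subtype.ext (Prod.ext (hs.trans hs'.symm) h))
      simpa using this
    rw [Finset.sum_mul]
    refine (Finset.sum_le_card_nsmul _ _ _ fun s _ => s.2).trans ?_
    rw [smul_eq_mul]
    exact Nat.mul_le_mul_right _ hGc
  have h3 := le_two_mul_card_goodTypes (κ := κ) hZ
  rw [card_seed]
  calc _ ≤ (∑ s ∈ G, (uncovered Z s.1).card) * (w * M) * (w * M) * K := by gcongr
    _ = ((∑ s ∈ G, (uncovered Z s.1).card) * K) * (w * M) * (w * M) := by ring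
    _ ≤ (Fintype.card Ty ^ Fintype.card κ * (2 * (Fintype.card F * z ^ (Fintype.card κ + 1)))) *
        (Fintype.card Ty * M) * (w * M) := by
      refine Nat.mul_le_mul_right _ (Nat.mul_le_mul (h2.trans ?_) (Nat.mul_le_mul_right _ hw))
      gcongr
    _ = 2 * z ^ (Fintype.card κ + 1) * (K * (M * (Fintype.card F * (w * M)))) := by
      rw [hK]; ring
    _ ≤ 2 * z ^ (Fintype.card κ + 1) * ((2 * Fintype.card (GoodTypes κ Z z)) *
        (M * (Fintype.card F * (w * M)))) := by gcongr
    _ = _ := by ring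

end counting

end HardInstance

/-! ### The hard instances -/

namespace HardInstance

variable {E F κ Ty R : Type} {M w n m z : ℕ} {Z : E → Finset Ty}
  {a : Fin n ≃ Element E F κ} {b : Fin m ≃ Family Ty κ R M}

/-- The unmodified instance. -/
noncomputable def base (a : Fin n ≃ Element E F κ) (b : Fin m ≃ Family Ty κ R M)
    (Z : E → Finset Ty) : SetSystem n m :=
  .ofIncidence a b (Incident Z) (fun _ => 1) (fun _ => 1) fun _ _ => Iff.rfl

theorem marker_unique {S : Family Ty κ R M} {o o' : Option κ}
    (h : Incident (F := F) Z S (.inr (.inr o))) (h' : Incident (F := F) Z S (.inr (.inr o'))) :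
    o = o' := by
  rcases S with s | s | s | s
  · exact Eq.trans h (Eq.symm h')
  · exact absurd h id
  · exact Eq.trans h (Eq.symm h')
  · exact absurd h id

theorem mem_elts_base {S : Fin m} {e : Fin n} :
    e ∈ (base a b Z).elts S ↔ Incident Z (b S) (a e) :=
  SetSystem.mem_elts_ofIncidence _

variable [Fintype Ty]

theorem exists_isCover_base [Nonempty Ty] [NeZero M] (hZ : ∀ e, (Z e).card < Fintype.card Ty) :
    ∃ C, (base a b Z).IsCover C := by
  refine ⟨Finset.univ, fun e => ?_⟩
  suffices h : ∃ S, Incident Z S (a e) by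
    obtain ⟨S, hS⟩ := h
    exact ⟨b.symm S, Finset.mem_univ _, mem_elts_base.2 (by simpa using hS)⟩
  have t₀ : Ty := Classical.arbitrary Ty
  rcases a e with e | f | _ | i
  · obtain ⟨t, ht⟩ : ∃ t, t ∉ Z e := by
      by_contra! h
      have : Z e = Finset.univ := Finset.eq_univ_iff_forall.2 h
      exact absurd (hZ e) (by rw [this, Finset.card_univ]; exact lt_irrefl _)
    exact ⟨.inl (t, 0), ht⟩
  · exact ⟨.inl (t₀, 0), trivial⟩
  · exact ⟨.inl (t₀, 0), rfl⟩
  · exact ⟨.inr (.inr (.inl (i, t₀))), rfl⟩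

/-- The type of a set, if it has one. -/
def typeOf : Family Ty κ R M → Option Ty
  | .inl s => some s.1
  | .inr (.inl s) => some s.1
  | .inr (.inr (.inl s)) => some s.2
  | .inr (.inr (.inr _)) => none

variable [DecidableEq Ty]

/-- A cover of the unmodified instance contains more types than a covering design allows. -/
theorem lt_card_of_isCover_base {k : ℕ} (hcov : ∀ A : Finset Ty, A.card ≤ k → ∃ e, A ⊆ Z e)
    {C : Finset (Fin m)} (hC : (base a b Z).IsCover C) : k < C.card := by
  by_contra! hk
  have h : (Finset.univ.filter fun t => ∃ S ∈ C, typeOf (b S) = some t).card ≤ C.card := by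
    rw [← Finset.card_map Function.Embedding.some]
    refine (Finset.card_le_card (t := C.image fun S => typeOf (b S)) fun o ho => ?_).trans
      Finset.card_image_le
    simp only [Finset.mem_map, Finset.mem_filter, Finset.mem_univ, true_and] at ho
    obtain ⟨t, ⟨S, hS, hSt⟩, rfl⟩ := ho
    exact Finset.mem_image.2 ⟨S, hS, hSt⟩
  obtain ⟨e, he⟩ := hcov _ (h.trans hk)
  obtain ⟨S, hS, heS⟩ := hC (a.symm (.inl e))
  rw [mem_elts_base, Equiv.apply_symm_apply] at heS
  have hmem : ∀ t, typeOf (b S) = some t → t ∈ Z e := fun t ht =>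
    he (Finset.mem_filter.2 ⟨Finset.mem_univ _, S, hS, ht⟩)
  rcases hbS : b S with s | s | s | s <;> rw [hbS] at heS hmem
  · exact heS (hmem _ rfl)
  · exact heS (hmem _ rfl)
  · exact heS (hmem _ rfl)
  · exact heS

variable [Fintype E] [Fintype κ]

/-- The set of the hidden cover that is modified. -/
def Seed.head (R : Type) (i : Seed κ F Z z M w) : Family Ty κ R M := .inl (i.1.1.1, i.2.1)

theorem not_incident_head {i : Seed κ F Z z M w} {e : E} (he : e ∈ uncovered Z i.1.1) :
    ¬ Incident (F := F) Z (i.head R) (.inl e) :=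
  fun h => h (mem_uncovered.1 he).1

/-- The partner set with which the head set exchanges the main element `e`. -/
def Seed.partner (R : Type) (comp : ∀ e, Fin w ↪ {t // t ∉ Z e}) (i : Seed κ F Z z M w) (e : E) :
    Family Ty κ R M :=
  .inr (.inl (comp e i.2.2.2.1, i.2.2.2.2))

variable [AddCommGroup F]

/-- The fillers that a seed assigns to the main elements: a shift of a fixed embedding. -/
def Seed.filler (ι : E ↪ F) (i : Seed κ F Z z M w) : E ↪ F ⊕ Option κ :=
  (ι.trans (Equiv.addRight i.2.2.1).toEmbedding).trans Function.Embedding.inl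

theorem not_incident_partner (ι : E ↪ F) (comp : ∀ e, Fin w ↪ {t // t ∉ Z e})
    (i : Seed κ F Z z M w) (e : E) : ¬ Incident Z (i.partner R comp e) (.inr (i.filler ι e)) :=
  fun h => h

variable {ι : E ↪ F} {comp : ∀ e, Fin w ↪ {t // t ∉ Z e}}

variable [DecidableEq E] [DecidableEq κ]

section

variable [Fintype F]

/-- Any given incidence is displaced by few of the seeds. -/
theorem card_displaced_le (hZ : ∀ e, (Z e).card = z) (hw : w ≤ Fintype.card Ty)
    (hEF : Fintype.card E ≤ Fintype.card F) {S : Family Ty κ R M} {x : Element E F κ}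
    (P : Seed κ F Z z M w → Prop)
    (hP : ∀ i, P i → (∃ e ∈ uncovered Z i.1.1, S = i.head R ∧ x = .inr (i.filler ι e)) ∨
      ∃ e ∈ uncovered Z i.1.1, S = i.partner R comp e ∧ x = .inl e) :
    Nat.card {i // P i} * (w * M) * Fintype.card Ty ^ (Fintype.card κ + 1) ≤
      4 * z ^ (Fintype.card κ + 1) * Fintype.card (Seed κ F Z z M w) := by
  classical
  rw [Nat.card_eq_fintype_card, Fintype.card_subtype]
  have none : (∀ i, ¬ P i) → (Finset.univ.filter P).card * (w * M) *
      Fintype.card Ty ^ (Fintype.card κ + 1) ≤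
        4 * z ^ (Fintype.card κ + 1) * Fintype.card (Seed κ F Z z M w) := fun h => by
    rw [Finset.filter_false_of_mem fun i _ => h i, Finset.card_empty, zero_mul, zero_mul]
    exact Nat.zero_le _
  rcases x with e | f | o
  · rcases S with s | s | s | s
    · exact none fun i hi => by simpa [Seed.head, Seed.partner] using hP i hi
    · refine le_trans ?_ (card_displaced_main hZ
        (fun e => (comp e).trans (Function.Embedding.subtype _)) e s.1 s.2)
      gcongr with i
      intro hi
      rcases hP i hi with ⟨_, _, _, h⟩ | ⟨e', he', hS, hx⟩
      · cases h
      · cases hx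
        simp only [Seed.partner, Sum.inr.injEq, Sum.inl.injEq] at hS
        exact ⟨he', by rw [hS]; rfl, by rw [hS]⟩
    · exact none fun i hi => by simpa [Seed.head, Seed.partner] using hP i hi
    · exact none fun i hi => by simpa [Seed.head, Seed.partner] using hP i hi
  · rcases S with s | s | s | s
    · refine le_trans ?_ (card_displaced_filler hZ hw hEF ι s.1 s.2 f)
      gcongr with i
      intro hi
      rcases hP i hi with ⟨e, he, hS, hx⟩ | ⟨_, _, _, h⟩
      · simp only [Seed.head, Sum.inl.injEq] at hS
        simp only [Seed.filler, Sum.inr.injEq] at hx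
        exact ⟨by rw [hS], by rw [hS], e, he, (Sum.inl.inj hx).symm⟩
      · cases h
    · exact none fun i hi => by simpa [Seed.head, Seed.partner] using hP i hi
    · exact none fun i hi => by simpa [Seed.head, Seed.partner] using hP i hi
    · exact none fun i hi => by simpa [Seed.head, Seed.partner] using hP i hi
  · exact none fun i hi => by simpa [Seed.filler] using hP i hi

end

variable [DecidableEq R]

/-- The modified instance, in which the head set of the seed also contains all main elements that
the types of the hidden cover leave uncovered. -/
noncomputable def modified (a : Fin n ≃ Element E F κ) (b : Fin m ≃ Family Ty κ R M)
    (ι : E ↪ F) (comp : ∀ e, Fin w ↪ {t // t ∉ Z e}) (i : Seed κ F Z z M w) : SetSystem n m :=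
  .ofIncidence a b (Incident Z)
    (setExchange (i.filler ι) (uncovered Z i.1.1) (i.head R) (i.partner R comp))
    (elementExchange (i.filler ι) (uncovered Z i.1.1) (i.head R) (i.partner R comp))
    (exchange_compatible (fun _ he => not_incident_head he) (fun _ _ => trivial)
      (fun e _ => (comp e i.2.2.2.1).2) (fun e _ => not_incident_partner ι comp i e))

theorem mem_elts_modified {i : Seed κ F Z z M w} {S : Fin m} {e : Fin n} :
    e ∈ (modified a b ι comp i).elts S ↔ Incident Z (b S)
      (setExchange (i.filler ι) (uncovered Z i.1.1) (i.head R) (i.partner R comp) (b S) (a e)) := by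
  rw [modified, SetSystem.mem_elts_ofIncidence, setExchange, exchange_symm]

theorem setExchange_marker (i : Seed κ F Z z M w) (S : Family Ty κ R M) (o : Option κ) :
    setExchange (i.filler ι) (uncovered Z i.1.1) (i.head R) (i.partner R comp) S
      (.inr (.inr o)) = .inr (.inr o) :=
  exchange_inr_of_forall _ fun e _ => by simp [Seed.filler]

/-- Distinct markers require distinct sets, and exchanges do not affect markers. -/
theorem card_lt_of_isCover_modified {i : Seed κ F Z z M w} {C : Finset (Fin m)}
    (hC : (modified a b ι comp i).IsCover C) : Fintype.card κ < C.card := by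
  rw [Nat.lt_iff_add_one_le, ← Fintype.card_option, ← Finset.card_univ]
  choose S hSC hS using fun o : Option κ => hC (a.symm (.inr (.inr o)))
  refine Finset.card_le_card_of_injOn S (fun o _ => hSC o) fun o _ o' _ h => ?_
  have h1 := hS o
  have h2 := hS o'
  rw [mem_elts_modified, Equiv.apply_symm_apply, setExchange_marker] at h1 h2
  rw [← h] at h2
  exact marker_unique h1 h2

/-- The hidden cover. The fillers that its head set loses are still in its other sets, which is
where `κ` has to be nonempty. -/
theorem exists_isCover_modified [Nonempty κ] (i : Seed κ F Z z M w) :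
    ∃ C, (modified a b ι comp i).IsCover C ∧ C.card ≤ Fintype.card κ + 1 := by
  set grp : κ → Family Ty κ R M := fun j => .inr (.inr (.inl (j, i.1.1.2 j))) with hgrp
  refine ⟨insert (b.symm (i.head R)) (Finset.univ.image fun j => b.symm (grp j)), fun e => ?_,
    (Finset.card_insert_le _ _).trans (Nat.add_le_add_right Finset.card_image_le _)⟩
  have hhead : ∀ x, setExchange (i.filler ι) (uncovered Z i.1.1) (i.head R) (i.partner R comp)
      (i.head R) x = exchange (i.filler ι) (uncovered Z i.1.1) x := by
    intro x
    simp [setExchange]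
  have hgroup : ∀ j x, setExchange (i.filler ι) (uncovered Z i.1.1) (i.head R) (i.partner R comp)
      (grp j) x = x := by
    intro j x
    have : ((uncovered Z i.1.1).filter fun e => grp j = i.head R ∨ grp j = i.partner R comp e) =
        ∅ := by
      simp [hgrp, Seed.head, Seed.partner]
    rw [setExchange, this]
    rcases x with e | f
    · exact exchange_inl_of_notMem _ (Finset.notMem_empty _)
    · exact exchange_inr_of_forall _ (by simp)
  have use_head : Incident Z (i.head R) (exchange (i.filler ι) (uncovered Z i.1.1) (a e)) →
      ∃ S ∈ insert (b.symm (i.head R)) (Finset.univ.image fun j => b.symm (grp j)),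
        e ∈ (modified a b ι comp i).elts S := fun h =>
    ⟨_, Finset.mem_insert_self _ _, mem_elts_modified.2 (by
      rw [Equiv.apply_symm_apply, hhead]; exact h)⟩
  have use_group : ∀ j, Incident Z (grp j) (a e) →
      ∃ S ∈ insert (b.symm (i.head R)) (Finset.univ.image fun j => b.symm (grp j)),
        e ∈ (modified a b ι comp i).elts S := fun j h =>
    ⟨b.symm (grp j), Finset.mem_insert_of_mem (Finset.mem_image_of_mem _ (Finset.mem_univ j)),
      mem_elts_modified.2 (by rw [Equiv.apply_symm_apply, hgroup]; exact h)⟩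
  rcases hae : a e with e' | f | _ | j <;> rw [hae] at use_head use_group
  · by_cases he : e' ∈ uncovered Z i.1.1
    · exact use_head (by rw [exchange_inl_of_mem _ he]; trivial)
    · by_cases h : i.1.1.1 ∈ Z e'
      · rw [mem_uncovered] at he
        push Not at he
        obtain ⟨j, hj⟩ := he h
        exact use_group j hj
      · exact use_head (by rw [exchange_inl_of_notMem _ he]; exact h)
  · exact use_group (Classical.arbitrary κ) trivial
  · refine use_head ?_
    rw [exchange_inr_of_forall _ fun e _ => by simp [Seed.filler]]
    rfl
  · exact use_group j rfl

theorem hasOpt_modified [Nonempty κ] (i : Seed κ F Z z M w) {k : ℕ}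
    (hk : Fintype.card κ + 1 = k) : (modified a b ι comp i).HasOpt k := by
  obtain ⟨C, hC, hcard⟩ := exists_isCover_modified (a := a) (b := b) (ι := ι) (comp := comp) i
  rw [← hk]
  refine ⟨⟨C, hC, le_antisymm hcard (card_lt_of_isCover_modified hC)⟩, ?_⟩
  rintro _ ⟨C', hC', rfl⟩
  exact card_lt_of_isCover_modified hC'

end HardInstance

/-! ### The lower bound for a given design -/

open MeasureTheory in
/-- The lower bound for an arbitrary covering design `Z` of `N` blocks of size `z` on `D` points, and
any kind of output that cannot be correct both for an instance with optimum `k` and for one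
with optimum greater than `a`. -/
theorem exists_hasOpt_pos_measure_le_queries {n m k a D z N : ℕ} (hk : 2 ≤ k)
    {Z : Fin N → Finset (Fin D)} (hZ : ∀ e, (Z e).card = z) (hz : z < D)
    (hcov : ∀ A : Finset (Fin D), A.card ≤ a → ∃ e, A ⊆ Z e) (hn : 2 * N + k ≤ n)
    (hm : 2 * D * (k + 1) ≤ m) {T : ℝ}
    (hT : T * (128 * ((z : ℝ) / D) ^ k * D) ≤ (D - z) * m)
    {Out : Type} {Ω : Type*} [MeasurableSpace Ω] (μ : Measure Ω) [IsProbabilityMeasure μ]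
    {A : Ω → QueryAlgorithm n m Out} {correct : SetSystem n m → Out → Prop}
    (hA : SolvesWithProb μ A correct (2 / 3))
    (hdisj : ∀ (I₀ I : SetSystem n m) (o : Out), (∀ C, I₀.IsCover C → a < C.card) → I.HasOpt k →
      correct I₀ o → ¬ correct I o) :
    ∃ I : SetSystem n m, I.HasOpt k ∧ 0 < μ {ω | T ≤ ((A ω).queries I : ℝ)} := by
  classical
  obtain ⟨k, rfl⟩ : ∃ l, k = l + 1 := ⟨k - 1, by omega⟩
  have hD : 0 < D := by omega
  have hN : 0 < N := (hcov ∅ (by simp)).choose.pos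
  -- the number of copies of each head set and partner set
  obtain ⟨M, hM, hMm, hM8⟩ : ∃ M, 0 < M ∧ 2 * (D * M) + k * D ≤ m ∧ m ≤ 8 * (D * M) := by
    have h1 : 2 * D * ((m - k * D) / (2 * D)) ≤ m - k * D := Nat.mul_div_le _ _
    have h2 : m - k * D < 2 * D * ((m - k * D) / (2 * D)) + 2 * D :=
      Nat.lt_mul_div_succ _ (by omega)
    have h3 : 2 * D * (k + 1 + 1) = 2 * (k * D) + 4 * D := by ring
    have h4 : 1 ≤ (m - k * D) / (2 * D) := by
      rw [Nat.le_div_iff_mul_le (by omega)]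
      omega
    have h5 : D ≤ D * ((m - k * D) / (2 * D)) := Nat.le_mul_of_pos_right _ h4
    rw [mul_assoc] at h1 h2
    exact ⟨_, h4, by omega, by omega⟩
  obtain ⟨f, hf⟩ : ∃ f, n = N + (f + (k + 1)) := ⟨n - N - (k + 1), by omega⟩
  obtain ⟨r, hr⟩ : ∃ r, m = D * M + (D * M + (k * D + r)) := ⟨m - 2 * (D * M) - k * D, by omega⟩
  have : NeZero f := ⟨by omega⟩
  have : NeZero M := ⟨by omega⟩
  have : Nonempty (Fin D) := ⟨⟨0, hD⟩⟩
  have : Nonempty (Fin k) := ⟨⟨0, by omega⟩⟩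
  have ea : Fin n ≃ HardInstance.Element (Fin N) (ZMod f) (Fin k) :=
    Fintype.equivOfCardEq (by simp [ZMod.card, hf])
  have eb : Fin m ≃ HardInstance.Family (Fin D) (Fin k) (Fin r) M :=
    Fintype.equivOfCardEq (by simp [hr])
  obtain ⟨ι⟩ : Nonempty (Fin N ↪ ZMod f) :=
    Function.Embedding.nonempty_of_card_le (by rw [ZMod.card, Fintype.card_fin]; omega)
  have comp : ∀ e, Fin (D - z) ↪ {t // t ∉ Z e} := fun e =>
    (Fintype.equivOfCardEq (by
      rw [Fintype.card_fin, Fintype.card_subtype_compl, Fintype.card_fin,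
        Fintype.card_coe, hZ])).toEmbedding
  set X := HardInstance.Seed (Fin k) (ZMod f) Z z M (D - z)
  have hgood : 0 < Fintype.card (HardInstance.GoodTypes (Fin k) Z z) := by
    have h1 := HardInstance.le_two_mul_card_goodTypes (κ := Fin k) hZ
    have h2 : 0 < Fintype.card (Fin D) ^ (Fintype.card (Fin k) + 1) := by
      rw [Fintype.card_fin]; positivity
    omega
  have : Nonempty (HardInstance.GoodTypes (Fin k) Z z) := Fintype.card_pos_iff.1 hgood
  have : Nonempty (Fin (D - z)) := ⟨⟨0, by omega⟩⟩
  have : Nonempty X := inferInstance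
  have hwM : (0 : ℝ) < ((D - z : ℕ) : ℝ) * M := by
    have h1 : 0 < D - z := by omega
    positivity
  have hDk : (0 : ℝ) < (D : ℝ) ^ (k + 1) := by positivity
  -- the number of seeds that a single query can tell apart from the unmodified instance
  set B : ℝ := 4 * z ^ (k + 1) * Fintype.card X / (((D - z : ℕ) : ℝ) * M * D ^ (k + 1)) with hBdef
  have hB : 0 ≤ B := by positivity
  have hdisp : ∀ (S : HardInstance.Family (Fin D) (Fin k) (Fin r) M)
      (x : HardInstance.Element (Fin N) (ZMod f) (Fin k)) (P : X → Prop)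
      (_ : ∀ i, P i → (∃ e ∈ HardInstance.uncovered Z i.1.1,
          S = i.head (Fin r) ∧ x = .inr (i.filler ι e)) ∨
        ∃ e ∈ HardInstance.uncovered Z i.1.1, S = i.partner (Fin r) comp e ∧ x = .inl e),
      (Nat.card {i // P i} : ℝ) ≤ B := by
    intro S x P hP
    have h := HardInstance.card_displaced_le (κ := Fin k) (F := ZMod f) (M := M) (ι := ι)
      (comp := comp) hZ (by rw [Fintype.card_fin]; omega)
      (by rw [Fintype.card_fin, ZMod.card]; omega) P hP
    have hD' : Fintype.card (Fin D) ^ (Fintype.card (Fin k) + 1) = D ^ (k + 1) := by simp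
    have hz' : z ^ (Fintype.card (Fin k) + 1) = z ^ (k + 1) := by simp
    have h' : Nat.card {i // P i} * ((D - z) * M) * D ^ (k + 1) ≤
        4 * z ^ (k + 1) * Fintype.card X :=
      (congrArg (_ * ·) hD').symm.trans_le (h.trans_eq (congrArg (4 * · * _) hz'))
    rw [hBdef, le_div_iff₀ (by positivity), ← mul_assoc]
    exact_mod_cast h'
  have hopt : ∀ i : X, (HardInstance.modified ea eb ι comp i).HasOpt (k + 1) := fun i =>
    HardInstance.hasOpt_modified i (by simp)
  obtain ⟨i, hi⟩ := QueryAlgorithm.exists_pos_measure_le_queries μ hA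
    (HardInstance.exists_isCover_base (a := ea) (b := eb) (Z := Z) (by
      intro e; rw [hZ, Fintype.card_fin]; exact hz))
    (I := fun i : X => HardInstance.modified ea eb ι comp i)
    (fun i => (HardInstance.exists_isCover_modified i).imp fun _ h => h.1)
    (fun i o => hdisj _ _ o (fun C hC => HardInstance.lt_card_of_isCover_base hcov hC) (hopt i))
    (B := B) (T := T) hB
    (SetSystem.card_elts_ofIncidence_ne_le _ _ hB fun S x hS => hdisp S x _ fun i hi =>
      of_setExchange_ne (fun _ he => HardInstance.not_incident_head he)
        (fun e _ => HardInstance.not_incident_partner ι comp i e) hS hi)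
    (SetSystem.card_sets_ofIncidence_ne_le _ _ hB fun S x hS => hdisp S x _ fun i hi =>
      of_elementExchange_ne (fun _ he => HardInstance.not_incident_head he)
        (fun e _ => HardInstance.not_incident_partner ι comp i e) hS hi) (by
      have hX : (0 : ℝ) < Fintype.card X := by exact_mod_cast Fintype.card_pos
      have hM8' : (m : ℝ) ≤ 8 * (D * M) := by exact_mod_cast hM8
      have hDz : ((D - z : ℕ) : ℝ) = D - z := by rw [Nat.cast_sub hz.le]
      have hD' : (0 : ℝ) < D := by exact_mod_cast hD
      have hzD : (0 : ℝ) < D - z := by rw [← hDz]; exact_mod_cast Nat.sub_pos_of_lt hz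
      have h1 : T * (16 * ((z : ℝ) / D) ^ (k + 1)) ≤ (D - z) * M := by
        have h2 : T * (128 * ((z : ℝ) / D) ^ (k + 1) * D) ≤ (D - z) * (8 * (D * M)) :=
          hT.trans (mul_le_mul_of_nonneg_left hM8' hzD.le)
        have h3 : (8 * D) * (T * (16 * ((z : ℝ) / D) ^ (k + 1))) ≤ (8 * D) * ((D - z) * M) := by
          linarith
        exact le_of_mul_le_mul_left h3 (by positivity)
      rw [hBdef, hDz, mul_div_assoc', div_le_div_iff₀ (by rw [← hDz]; positivity) (by norm_num)]
      rw [div_pow, mul_div_assoc', mul_div_assoc', div_le_iff₀ hDk] at h1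
      nlinarith)
  exact ⟨_, hopt i, hi⟩

/-! ### The choice of the design -/

/-- The parameters of a hard instance: a covering design of `N` blocks of size `z` on `D` points for
the subsets of size at most `α * k`, small enough for the hard instance to have at most `n` elements and sets, and
sparse enough for `(z / D) ^ k`, the probability that `k` random points lie in a given block,
to be at most of the order of `(1 - z / D) / y`. -/
def HasSparseDesign (n k : ℕ) (α y C : ℝ) : Prop :=
  ∃ (D z N : ℕ) (Z : Fin N → Finset (Fin D)), (∀ e, (Z e).card = z) ∧ z < D ∧
    (∀ A : Finset (Fin D), A.card ≤ ⌊α * k⌋₊ → ∃ e, A ⊆ Z e) ∧ 2 * N + k ≤ n ∧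
    2 * D * (k + 1) ≤ n ∧ y * (128 * ((z : ℝ) / D) ^ k * D) ≤ C * (D - z)

/-- The complements of points form a design that is good enough for bounded `n`. -/
theorem hasSparseDesign_of_mul_le {n k : ℕ} {α y : ℝ} (hk : 2 ≤ k) (hα : 1 < α) (hy : 0 ≤ y)
    (hn : 16 * (α * k ^ 2) ≤ n) : HasSparseDesign n k α y (y * (128 * n)) := by
  set a := ⌊α * k⌋₊ with ha
  have hk' : (2 : ℝ) ≤ k := by exact_mod_cast hk
  have ha' : (a : ℝ) ≤ α * k := Nat.floor_le (by positivity)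
  have hαk : (k : ℝ) ≤ α * k := le_mul_of_one_le_left (by positivity) hα.le
  have hαk2 : 2 * (α * k) ≤ α * k ^ 2 := by nlinarith
  have h2 : 2 * (a + 1) * (k + 1) ≤ n := by
    have : (2 * (a + 1) * (k + 1) : ℝ) ≤ n := by nlinarith
    exact_mod_cast this
  refine ⟨a + 1, a, a + 1, fun e => {e}ᶜ, fun e => ?_, a.lt_succ_self, fun A hA => ?_, ?_, h2, ?_⟩
  · rw [Finset.card_compl, Finset.card_singleton, Fintype.card_fin, Nat.add_sub_cancel]
  · obtain ⟨e, he⟩ : ∃ e, e ∉ A := by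
      by_contra! h
      have h1 : A = Finset.univ := Finset.eq_univ_iff_forall.2 h
      rw [h1, Finset.card_univ, Fintype.card_fin] at hA
      omega
    exact ⟨e, fun t ht => by
      rw [Finset.mem_compl, Finset.mem_singleton]
      rintro rfl
      exact he ht⟩
  · nlinarith
  · have h3 : ((a : ℝ) / (a + 1 : ℕ)) ^ k ≤ 1 :=
      pow_le_one₀ (by positivity) (div_le_one_of_le₀ (by push_cast; linarith) (by positivity))
    have h4 : ((a + 1 : ℕ) : ℝ) ≤ n := by
      have : a + 1 ≤ n := by nlinarith
      exact_mod_cast this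
    have h5 : 128 * ((a : ℝ) / (a + 1 : ℕ)) ^ k * (a + 1 : ℕ) ≤ 128 * n := by
      nlinarith [Nat.cast_nonneg (α := ℝ) (a + 1)]
    calc _ ≤ y * (128 * n) := mul_le_mul_of_nonneg_left h5 hy
      _ = _ := by push_cast; ring

/-- The size of the parameters relative to `x = n ^ (1 / 20)`. -/
theorem scale_bounds {n k : ℕ} {α x : ℝ} (hk : 2 ≤ k) (hα : 1 < α)
    (hkn : (k : ℝ) ^ (4 * α + 1) ≤ n) (hx0 : 0 < x) (hxn : x ^ 20 = n) :
    (k : ℝ) ≤ x ^ 4 ∧ 1 ≤ ((n : ℝ) / k) ^ (1 / (2 * α)) ∧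
      k * ((n : ℝ) / k) ^ (1 / (2 * α)) ≤ x ^ 12 ∧
      k * (k * ((n : ℝ) / k) ^ (1 / (2 * α))) ^ α ≤ x ^ 16 := by
  have hk' : (2 : ℝ) ≤ k := by exact_mod_cast hk
  have hk0 : (0 : ℝ) < k := by linarith
  have hn0 : (0 : ℝ) < n := hxn ▸ by positivity
  have hk5 : (k : ℝ) ^ (5 : ℕ) ≤ n := by
    refine le_trans ?_ hkn
    rw [← Real.rpow_natCast]
    exact Real.rpow_le_rpow_of_exponent_le (by linarith) (by push_cast; linarith)
  have hkx : (k : ℝ) ≤ x ^ 4 := by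
    refine le_of_pow_le_pow_left₀ (n := 5) (by norm_num) (by positivity) ?_
    rw [← pow_mul, hxn]
    exact hk5
  -- as `α > 1`, ten times `α + 1 / 2` is less than three times `4 * α + 1`
  have hkα : (k : ℝ) ^ (α + 1 / 2) ≤ x ^ 6 := by
    refine le_of_pow_le_pow_left₀ (n := 10) (by norm_num) (by positivity) ?_
    calc ((k : ℝ) ^ (α + 1 / 2)) ^ 10 = (k : ℝ) ^ ((α + 1 / 2) * (10 : ℕ)) := by
          rw [Real.rpow_mul_natCast hk0.le]
      _ ≤ (k : ℝ) ^ ((4 * α + 1) * (3 : ℕ)) :=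
          Real.rpow_le_rpow_of_exponent_le (by linarith) (by push_cast; linarith)
      _ = ((k : ℝ) ^ (4 * α + 1)) ^ 3 := by rw [Real.rpow_mul_natCast hk0.le]
      _ ≤ (x ^ 20) ^ 3 := by rw [hxn]; gcongr
      _ = (x ^ 6) ^ 10 := by ring
  set y := ((n : ℝ) / k) ^ (1 / (2 * α)) with hy
  have hnk : 1 ≤ (n : ℝ) / k := by
    rw [one_le_div hk0]
    refine le_trans ?_ hk5
    exact le_self_pow₀ (by linarith) (by norm_num)
  have hy1 : 1 ≤ y := Real.one_le_rpow hnk (by positivity)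
  have hyα : y ^ α = ((n : ℝ) / k) ^ (1 / 2 : ℝ) := by
    rw [hy, ← Real.rpow_mul (by positivity)]
    congr 1
    field_simp
  have hy2 : y ^ 2 ≤ n / k := by
    calc y ^ 2 = y ^ (2 : ℝ) := (Real.rpow_two y).symm
      _ ≤ y ^ (2 * α) := Real.rpow_le_rpow_of_exponent_le hy1 (by linarith)
      _ = n / k := by
        rw [hy, ← Real.rpow_mul (by positivity), one_div_mul_cancel (by positivity), Real.rpow_one]
  set w := k * y with hw
  have hw0 : 0 < w := by positivity
  have hwx : w ≤ x ^ 12 := by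
    refine le_of_pow_le_pow_left₀ (n := 2) (by norm_num) (by positivity) ?_
    calc w ^ 2 = (k : ℝ) ^ 2 * y ^ 2 := by rw [hw, mul_pow]
      _ ≤ (k : ℝ) ^ 2 * (n / k) := by gcongr
      _ = (k : ℝ) * n := by field_simp
      _ ≤ x ^ 4 * x ^ 20 := by rw [hxn]; gcongr
      _ = (x ^ 12) ^ 2 := by ring
  refine ⟨hkx, hy1, hwx, ?_⟩
  have h1 : k * w ^ α = (k : ℝ) ^ (α + 1 / 2) * (n : ℝ) ^ (1 / 2 : ℝ) := by
    rw [hw, Real.mul_rpow hk0.le (by linarith), hyα, Real.div_rpow hn0.le hk0.le,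
      Real.rpow_add hk0]
    have h2 : (k : ℝ) ^ (1 / 2 : ℝ) * (k : ℝ) ^ (1 / 2 : ℝ) = k := by
      rw [← Real.rpow_add hk0]; norm_num
    have h3 : (k : ℝ) ^ (1 / 2 : ℝ) ≠ 0 := by positivity
    field_simp
    linear_combination -h2
  have h2 : (n : ℝ) ^ (1 / 2 : ℝ) = x ^ 10 := by
    rw [← hxn, ← Real.sqrt_eq_rpow, show x ^ 20 = (x ^ 10) ^ 2 by ring,
      Real.sqrt_sq (by positivity)]
  rw [h1, h2]
  calc _ ≤ x ^ 6 * x ^ 10 := by gcongr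
    _ = x ^ 16 := by ring

/-- The density `w ^ (-1 / k)`, for which `k` independent uniform points all lie in a block with
probability `1 / w`. -/
theorem exists_density {k : ℕ} {w : ℝ} (hk : 2 ≤ k) (hw2 : 2 ≤ w) :
    ∃ p : ℝ, 0 < p ∧ p ^ k = 1 / w ∧ p ≤ 1 - 1 / (2 * k) ∧ 1 ≤ p ^ 2 * w ∧
      ∀ (a : ℕ) (α : ℝ), a ≤ α * k → 1 ≤ p ^ a * w ^ α := by
  have hk' : (2 : ℝ) ≤ k := by exact_mod_cast hk
  have hk0 : (0 : ℝ) < k := by linarith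
  have hw0 : 0 < w := by linarith
  set p := (1 / w) ^ (1 / k : ℝ) with hp
  have hp0 : 0 < p := by positivity
  have hpk : p ^ k = 1 / w := by
    rw [hp, ← Real.rpow_mul_natCast (by positivity), one_div_mul_cancel hk0.ne', Real.rpow_one]
  have hp1 : p ≤ 1 - 1 / (2 * k) := by
    have h1 : 1 / (2 * k : ℝ) ≤ 1 / 4 := by
      rw [div_le_div_iff₀ (by positivity) (by norm_num)]; linarith
    refine le_of_pow_le_pow_left₀ (n := k) (by omega) (by linarith) ?_
    have h2 := one_add_mul_le_pow (a := -(1 / (2 * k : ℝ))) (by linarith) k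
    have h3 : 1 + (k : ℝ) * -(1 / (2 * k)) = 1 / 2 := by field_simp; norm_num
    have h4 : 1 / w ≤ 1 / 2 := one_div_le_one_div_of_le (by norm_num) hw2
    rw [hpk, sub_eq_add_neg]
    linarith
  have hp1' : p ≤ 1 := hp1.trans (sub_le_self _ (by positivity))
  refine ⟨p, hp0, hpk, hp1, ?_, fun a α ha => ?_⟩
  · have h1 : 1 / w ≤ p ^ 2 := hpk ▸ pow_le_pow_of_le_one hp0.le hp1' hk
    rwa [div_le_iff₀ hw0] at h1
  · have h1 : w ^ (-α) ≤ p ^ a := by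
      rw [hp, ← Real.rpow_mul_natCast (by positivity), one_div, Real.inv_rpow hw0.le,
        ← Real.rpow_neg hw0.le]
      refine Real.rpow_le_rpow_of_exponent_le (by linarith) (neg_le_neg ?_)
      rwa [one_div_mul_eq_div, div_le_iff₀ hk0]
    rwa [Real.rpow_neg hw0.le, inv_le_iff_one_le_mul₀ (by positivity)] at h1

/-- Rounding the block size and adding `a` points costs a factor of at most `1 + 1 / (4 * k)` in the
density. -/
theorem blockSize_bounds {k a D : ℕ} {p w : ℝ} (hk : 0 < k) (hD : 0 < D) (hw0 : 0 < w) (hp0 : 0 < p)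
    (hpk : p ^ k = 1 / w) (hp1 : p ≤ 1 - 1 / (2 * k)) (hround : 4 * k * (a + 1) ≤ p * D) :
    p * D ≤ ((⌈p * D⌉₊ + a : ℕ) : ℝ) - a ∧ (D : ℝ) ≤ 4 * k * (D - (⌈p * D⌉₊ + a : ℕ)) ∧
      (((⌈p * D⌉₊ + a : ℕ) : ℝ) / D) ^ k ≤ 3 / w := by
  have hk0 : (0 : ℝ) < k := by exact_mod_cast hk
  have hD0 : (0 : ℝ) < D := by exact_mod_cast hD
  have hp1' : p ≤ 1 := hp1.trans (sub_le_self _ (by positivity))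
  set z := ⌈p * D⌉₊ + a with hz
  have hz1 : p * D ≤ z - a := by
    rw [hz]; push_cast; linarith [Nat.le_ceil (p * D)]
  have hz2 : (z : ℝ) ≤ p * D * (1 + 1 / (4 * k)) := by
    have h1 : (z : ℝ) ≤ p * D + 1 + a := by
      rw [hz]; push_cast; linarith [Nat.ceil_lt_add_one (a := p * D) (by positivity)]
    have h2 : (a + 1 : ℝ) ≤ p * D * (1 / (4 * k)) := by
      rw [mul_one_div, le_div_iff₀ (by positivity)]
      linarith
    linarith
  have hzD' : (D : ℝ) ≤ 4 * k * (D - z) := by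
    have h1 : p * (1 + 1 / (4 * k)) ≤ 1 - 1 / (4 * k) := by
      have h2 : p * (1 / (4 * k)) ≤ 1 / (4 * k : ℝ) := mul_le_of_le_one_left (by positivity) hp1'
      have h3 : 1 / (2 * k : ℝ) = 1 / (4 * k) + 1 / (4 * k) := by field_simp; norm_num
      linarith
    have h2 : (z : ℝ) ≤ D * (1 - 1 / (4 * k)) := by nlinarith
    have h3 : D * (1 / (4 * k)) ≤ (D - z : ℝ) := by linarith
    rw [mul_one_div, div_le_iff₀ (by positivity)] at h3
    linarith
  refine ⟨hz1, hzD', ?_⟩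
  calc ((z : ℝ) / D) ^ k ≤ (p * (1 + 1 / (4 * k))) ^ k := by
        gcongr
        rw [div_le_iff₀ hD0]
        linarith
    _ = 1 / w * (1 + 1 / (4 * k)) ^ k := by rw [mul_pow, hpk]
    _ ≤ 1 / w * Real.exp (1 / (4 * k)) ^ k := by
        gcongr
        linarith [Real.add_one_le_exp (1 / (4 * k : ℝ))]
    _ = 1 / w * Real.exp (1 / 4) := by
        rw [← Real.exp_nat_mul]
        congr 2
        field_simp
    _ ≤ 1 / w * 3 := by
        gcongr
        have := Real.exp_one_lt_d9
        have h2 : Real.exp (1 / 4) ≤ Real.exp 1 := Real.exp_le_exp.2 (by norm_num)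
        linarith
    _ = 3 / w := by ring

/-- For large `n`, random blocks of density about `(k * y) ^ (-1 / k)` form a good enough design. -/
theorem hasSparseDesign_of_log_le {n k : ℕ} {α x : ℝ} (hk : 2 ≤ k) (hα : 1 < α)
    (hαn : α ≤ Real.log n) (hkn : (k : ℝ) ^ (4 * α + 1) ≤ n) (hx : 8 ≤ x) (hxn : x ^ 20 = n)
    (hlog : 12 * Real.log n ≤ x) :
    HasSparseDesign n k α (((n : ℝ) / k) ^ (1 / (2 * α))) 1536 := by
  have hx0 : 0 < x := by linarith
  have hk' : (2 : ℝ) ≤ k := by exact_mod_cast hk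
  have hk0 : (0 : ℝ) < k := by linarith
  obtain ⟨hkx, hy1, hwx, hkw⟩ := scale_bounds hk hα hkn hx0 hxn
  generalize ((n : ℝ) / k) ^ (1 / (2 * α)) = y at *
  set w := k * y with hw
  have hw2 : 2 ≤ w := by nlinarith
  have hw0 : 0 < w := by linarith
  obtain ⟨p, hp0, hpk, hp1, hp2, hpα⟩ := exists_density hk hw2
  have hp1' : p ≤ 1 := hp1.trans (sub_le_self _ (by positivity))
  have hpx : 1 ≤ p * x ^ 6 := by
    refine le_of_pow_le_pow_left₀ (n := 2) (by norm_num) (by positivity) ?_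
    rw [one_pow, mul_pow, ← pow_mul]
    exact hp2.trans (mul_le_mul_of_nonneg_left hwx (by positivity))
  set a := ⌊α * k⌋₊ with ha
  have ha' : (a : ℝ) ≤ α * k := Nat.floor_le (by positivity)
  have hpa := hpα a α ha'
  have hαx : α ≤ x / 12 := by linarith
  -- `n ^ (3 / 4)` points leave room for `k` groups of sets and make the rounding of `p * D` harmless
  set D := ⌈x ^ 15⌉₊ with hD
  have hD1 : x ^ 15 ≤ D := Nat.le_ceil _
  have hD2 : (D : ℝ) < x ^ 15 + 1 := Nat.ceil_lt_add_one (by positivity)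
  have hD0 : (0 : ℝ) < D := lt_of_lt_of_le (by positivity) hD1
  have one_le_pow : ∀ j : ℕ, 1 ≤ x ^ j := fun j => one_le_pow₀ (by linarith)
  have hDn : (D : ℝ) * (2 * (k + 1)) ≤ n := by
    calc (D : ℝ) * (2 * (k + 1)) ≤ (x ^ 15 + x ^ 15) * (2 * (x ^ 4 + x ^ 4)) := by
          gcongr
          · linarith [one_le_pow 15]
          · exact one_le_pow 4
      _ = 8 * x ^ 19 := by ring
      _ ≤ x * x ^ 19 := by gcongr
      _ = n := by rw [← hxn]; ring
  have hround : 4 * k * (a + 1) ≤ p * D := by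
    have h1 : (1 : ℝ) ≤ α * k := by nlinarith
    calc 4 * (k : ℝ) * (a + 1) ≤ 4 * x ^ 4 * (x / 12 * x ^ 4 + x / 12 * x ^ 4) := by
          have h2 : α * k ≤ x / 12 * x ^ 4 := by gcongr
          gcongr
          · exact ha'.trans h2
          · exact h1.trans h2
      _ ≤ 1 * x ^ 9 := by nlinarith [one_le_pow 9]
      _ ≤ (p * x ^ 6) * x ^ 9 := by gcongr
      _ = p * x ^ 15 := by ring
      _ ≤ p * D := by gcongr
  obtain ⟨hz1, hzD', hzk⟩ := blockSize_bounds (by omega) (by exact_mod_cast hD0) hw0 hp0 hpk hp1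
    hround
  generalize ⌈p * D⌉₊ + a = z at *
  have hzD : z < D := by
    have : (z : ℝ) < D := by
      by_contra! h
      nlinarith
    exact_mod_cast this
  set N := (n - k) / 2 with hN
  have hkn' : k ≤ n := by
    have : (k : ℝ) ≤ n := hkx.trans (hxn ▸ pow_le_pow_right₀ (by linarith) (by norm_num))
    exact_mod_cast this
  have hN3 : x ^ 20 / 3 ≤ N := by
    have h1 : n ≤ 2 * N + k + 1 := by omega
    have h2 : (n : ℝ) ≤ 2 * N + k + 1 := by exact_mod_cast h1
    have h3 : 8 ^ 16 * x ^ 4 ≤ x ^ 20 := by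
      calc 8 ^ 16 * x ^ 4 ≤ x ^ 16 * x ^ 4 := by gcongr
        _ = x ^ 20 := by ring
    rw [← hxn] at h2
    linarith [one_le_pow 4]
  have hlogD : Real.log D ≤ Real.log n := by
    refine Real.log_le_log hD0 (le_trans ?_ hDn)
    exact le_mul_of_one_le_right hD0.le (by linarith)
  have hdesign : a * Real.log D < N * ((z - a : ℝ) / D) ^ a := by
    have h1 : p ^ a ≤ ((z - a : ℝ) / D) ^ a := by
      gcongr
      rwa [le_div_iff₀ hD0]
    have h2 : a * Real.log D * w ^ α ≤ x ^ 18 / 144 := by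
      calc a * Real.log D * w ^ α ≤ α * k * Real.log n * w ^ α := by
            gcongr
        _ = α * Real.log n * (k * w ^ α) := by ring
        _ ≤ x / 12 * (x / 12) * x ^ 16 := by
            gcongr
            linarith
        _ = x ^ 18 / 144 := by ring
    have h3 : x ^ 18 ≤ x ^ 20 := pow_le_pow_right₀ (by linarith) (by norm_num)
    have h4 : a * Real.log D * w ^ α < N * p ^ a * w ^ α := by
      have h5 : (N : ℝ) * 1 ≤ N * (p ^ a * w ^ α) := by gcongr
      have h6 : 0 < x ^ 18 := by positivity
      linarith
    exact (lt_of_mul_lt_mul_right h4 (by positivity)).trans_le (by gcongr)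
  have haz : a ≤ z := by
    have h1 : 0 ≤ p * D := by positivity
    have h2 : (a : ℝ) ≤ z := by linarith
    exact_mod_cast h2
  obtain ⟨Z, hZ, hcov⟩ := exists_coveringDesign haz hzD.le
    (by exact_mod_cast hD0) hdesign
  refine ⟨D, z, N, Z, hZ, hzD, hcov, by omega, ?_, ?_⟩
  · have : D * (2 * (k + 1)) ≤ n := by exact_mod_cast hDn
    linarith
  · calc y * (128 * ((z : ℝ) / D) ^ k * D) ≤ y * (128 * (3 / w) * (4 * k * (D - z))) := by
          gcongr
      _ = 1536 * (D - z) := by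
          rw [hw]
          have : y ≠ 0 := by linarith
          field_simp
          ring

/-- All admissible parameters have a sparse design with the same constant; the choice of the design
depends on whether `n` is large. -/
theorem exists_forall_hasSparseDesign : ∃ C : ℝ, 0 < C ∧ ∀ (n m k : ℕ) (α : ℝ),
    n ≤ m → 2 ≤ k → 1 < α → α ≤ Real.log n →
    (k : ℝ) ≤ ((n : ℝ) / (16 * α * Real.log m)) ^ (1 / (4 * α + 1)) →
    HasSparseDesign n k α (((n : ℝ) / k) ^ (1 / (2 * α))) C := by
  obtain ⟨N₀, hN₀⟩ : ∃ N₀ : ℕ, ∀ n : ℕ, N₀ ≤ n →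
      8 ≤ (n : ℝ) ^ (1 / 20 : ℝ) ∧ 12 * Real.log n ≤ (n : ℝ) ^ (1 / 20 : ℝ) := by
    have h1 := (tendsto_rpow_atTop (y := 1 / 20) (by norm_num)).eventually_ge_atTop 8
    have h2 := (isLittleO_log_rpow_atTop (r := 1 / 20) (by norm_num)).bound
      (c := 1 / 12) (by norm_num)
    have h3 := tendsto_natCast_atTop_atTop.eventually (h1.and h2)
    obtain ⟨N₀, hN₀⟩ := Filter.eventually_atTop.1 h3
    refine ⟨N₀, fun n hn => ⟨(hN₀ n hn).1, ?_⟩⟩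
    have h4 := (hN₀ n hn).2
    rw [Real.norm_of_nonneg (by positivity : (0 : ℝ) ≤ (n : ℝ) ^ (1 / 20 : ℝ))] at h4
    linarith [le_abs_self (Real.log n), Real.norm_eq_abs (Real.log n)]
  refine ⟨max 1536 (N₀ * (128 * N₀)), by positivity, fun n m k α hnm hk hα hαn hkn => ?_⟩
  have weaken : ∀ {C C' : ℝ}, C ≤ C' → HasSparseDesign n k α (((n : ℝ) / k) ^ (1 / (2 * α))) C →
      HasSparseDesign n k α (((n : ℝ) / k) ^ (1 / (2 * α))) C' := by
    rintro C C' h ⟨D, z, N, Z, h1, h2, h3, h4, h5, h6⟩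
    have h7 : (0 : ℝ) ≤ D - z := by
      rw [sub_nonneg]; exact_mod_cast h2.le
    exact ⟨D, z, N, Z, h1, h2, h3, h4, h5, h6.trans (mul_le_mul_of_nonneg_right h h7)⟩
  have hk' : (2 : ℝ) ≤ k := by exact_mod_cast hk
  have hn0 : 0 < n := by
    rcases Nat.eq_zero_or_pos n with rfl | h
    · norm_num at hαn; linarith
    · exact h
  have hn0' : (0 : ℝ) < n := by exact_mod_cast hn0
  have hL : 1 ≤ Real.log m :=
    hα.le.trans (hαn.trans (Real.log_le_log hn0' (by exact_mod_cast hnm)))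
  have hpow : (k : ℝ) ^ (4 * α + 1) * (16 * α) ≤ n := by
    have h1 := Real.rpow_le_rpow (by positivity) hkn (by linarith : 0 ≤ 4 * α + 1)
    rw [← Real.rpow_mul (by positivity), one_div_mul_cancel (by linarith), Real.rpow_one,
      le_div_iff₀ (by positivity)] at h1
    refine le_trans ?_ h1
    have h2 : 16 * α ≤ 16 * α * Real.log m := le_mul_of_one_le_right (by linarith) hL
    gcongr
  by_cases hn : N₀ ≤ n
  · refine weaken (le_max_left _ _) (hasSparseDesign_of_log_le hk hα hαn ?_ (hN₀ n hn).1 ?_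
      (hN₀ n hn).2)
    · exact le_trans (le_mul_of_one_le_right (by positivity) (by linarith)) hpow
    · rw [← Real.rpow_mul_natCast hn0'.le]
      norm_num
  · push Not at hn
    have hnN : (n : ℝ) ≤ N₀ := by exact_mod_cast hn.le
    have hk2 : (k : ℝ) ^ 2 ≤ (k : ℝ) ^ (4 * α + 1) := by
      rw [← Real.rpow_two]
      exact Real.rpow_le_rpow_of_exponent_le (by linarith) (by linarith)
    have hkn2 : 16 * (α * k ^ 2) ≤ n := by nlinarith
    have hkn1 : (k : ℝ) ≤ n := by nlinarith
    have hy : ((n : ℝ) / k) ^ (1 / (2 * α)) ≤ n := by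
      have h1 : 1 ≤ (n : ℝ) / k := (one_le_div (by linarith)).2 hkn1
      calc ((n : ℝ) / k) ^ (1 / (2 * α)) ≤ ((n : ℝ) / k) ^ (1 : ℝ) :=
            Real.rpow_le_rpow_of_exponent_le h1
              (div_le_one_of_le₀ (by linarith) (by linarith))
        _ ≤ n := by
            rw [Real.rpow_one]
            exact div_le_self hn0'.le (by linarith)
    refine weaken (le_trans ?_ (le_max_right _ _))
      (hasSparseDesign_of_mul_le hk hα (by positivity) hkn2)
    gcongr
    exact hy.trans hnN

/-! ### The lower bound -/

theorem theorem3p1 :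
    ∃ c : ℝ, 0 < c ∧ ∃ d : ℕ, ∀ (n m k : ℕ) (α : ℝ),
      n ≤ m → 2 ≤ k → 1 < α → α ≤ Real.log n →
      (k : ℝ) ≤ ((n : ℝ) / (16 * α * Real.log m)) ^ (1 / (4 * α + 1)) →
      ∀ (Ω : Type*) [MeasurableSpace Ω] (μ : MeasureTheory.Measure Ω)
        [MeasureTheory.IsProbabilityMeasure μ],
        -- computing an approximate cover
        (∀ A : Ω → QueryAlgorithm n m (Finset (Fin m)),
          SolvesWithProb μ A (SetSystem.IsApproxCover α) (2 / 3) →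
          ∃ I : SetSystem n m, I.HasOpt k ∧
            0 < μ {ω | c * (m * ((n : ℝ) / k) ^ (1 / (2 * α))) / Real.log m ^ d
                        ≤ ((A ω).queries I : ℝ)}) ∧
        -- estimating the minimum size of a cover
        (∀ A : Ω → QueryAlgorithm n m ℝ,
          SolvesWithProb μ A (SetSystem.IsApproxValue α) (2 / 3) →
          ∃ I : SetSystem n m, I.HasOpt k ∧
            0 < μ {ω | c * (m * ((n : ℝ) / k) ^ (1 / (2 * α))) / Real.log m ^ d
                        ≤ ((A ω).queries I : ℝ)}) := by
  obtain ⟨C, hC, hdesign⟩ := exists_forall_hasSparseDesign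
  -- the bound holds without any logarithmic loss
  refine ⟨1 / C, by positivity, 0, fun n m k α hnm hk hα hαn hkn Ω _ μ _ => ?_⟩
  obtain ⟨D, z, N, Z, hZ, hz, hcov, hn, hD, hy⟩ := hdesign n m k α hnm hk hα hαn hkn
  have hT : 1 / C * (m * ((n : ℝ) / k) ^ (1 / (2 * α))) / Real.log m ^ 0 *
      (128 * ((z : ℝ) / D) ^ k * D) ≤ (D - z) * m := by
    rw [pow_zero, div_one, one_div_mul_eq_div, div_mul_eq_mul_div, div_le_iff₀ hC]
    have h := mul_le_mul_of_nonneg_left hy (Nat.cast_nonneg (α := ℝ) m)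
    linarith
  constructor
  · intro A hA
    refine exists_hasOpt_pos_measure_le_queries hk hZ hz hcov hn (hD.trans hnm) hT μ hA ?_
    rintro I₀ I o h₀ hI ⟨ho, -⟩ ⟨-, t, ht, hle⟩
    rw [ht.unique hI] at hle
    exact (h₀ o ho).not_ge (Nat.le_floor hle)
  · intro A hA
    refine exists_hasOpt_pos_measure_le_queries hk hZ hz hcov hn (hD.trans hnm) hT μ hA ?_
    rintro I₀ I o h₀ hI ⟨s, ⟨⟨B, hB, rfl⟩, -⟩, hs, -⟩ ⟨t, ht, -, hle⟩
    rw [ht.unique hI] at hle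
    exact (h₀ B hB).not_ge (Nat.le_floor (hs.trans hle))
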